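/- **Setting.** Let $D,n\ge 0$ and let $A_\mu:\mathbb R^D\to M_n(\mathbb C)$, $\mu=1,\dots,D$, be a continuous gauge field with Hermitian values. Put $\hat\pi_\mu=\hat p_\mu-A_\mu(\hat x)$ with $\hat p_\mu=-i\partial_\mu$, acting on $\mathbb C^n$-valued wave functions on $\mathbb R^D$. For $y\in\mathbb R^D$ let $e^{iy\hat\pi}$ be the time-one map of the flow $\partial_t u=iy\hat\pi u=y^\mu(\partial_\mu-iA_\mu)u$. Let $$U(w,x)=\lim_{N\to\infty}f_N(N)f_N(N-1)\cdots f_N(0),\qquad f_N(j)=1+\tfrac iN(w-x)^\mu A_\mu\!\left(x+\tfrac jN(w-x)\right)$$ be the parallel transporter along the straight segment from $x$ to $w$. The matrix element $\langle x|T|x'\rangle$ of an operator $T$ is the matrix $M$ such that $(T\rho_mv)(x)\to Mv$ for every $v\in\mathbb C^n$ and every sequence of nonnegative, smooth, compactly supported $\rho_m$ with $\int\rho_m=1$ whose supports shrink to $x'$. The generalized Weyl symbol (Wigner transform) of $\hat X$ is $$X_W(x,p)=\int dy\,e^{ipy}\,\langle x|e^{-\frac i2y\hat\pi}\hat Xe^{-\frac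 i2y\hat\pi}|x\rangle .$$ We consider integral operators $\hat X,\hat Y$ with continuous matrix-valued kernels for which, at every $x$, these matrix elements exist for all $y$ and the integral converges absolutely, and for which $X_W$, $Y_W$ are Schwartz functions on phase space $\mathbb R^D\times\mathbb R^D$. The generalized star product of their symbols is the symbol of the operator product, $X_W\bigstar Y_W=(\hat X\hat Y)_W$. **Theorem 2.** For all such $\hat X,\hat Y$ the integral defining $(\hat X\hat Y)_W$ converges absolutely at every $x$, the star product $X_W\bigstar Y_W$ is well defined (it depends only on the two symbols), and for all $x,p$ $$\begin{aligned} (X_W\bigstar Y_W)(x,p)&=(\hat X\hat Y)_W(x,p)\\ &=(2\pi)^{-4D}\int dw\,e^{ipw}\int dq\,dy\,dz\,dk\,dq'\,dy'\,dz'\,dk'\;e^{-i(yk+qz+y'k'+q'z')}\\ &\quad\times\langle x|e^{-\frac i2w\hat\pi}e^{\frac i2y\hat\pi}e^{iq\hat x}X_W(z,k)e^{\frac i2y\hat\pi}e^{\frac i2y'\hat\pi}e^{iq'\hat x}Y_W(z',k')e^{\frac i2y'\hat\pi}e^{-\frac i2w\hat\pi}|x\rangle\\ &=(2\pi)^{-2D}\int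 dy\,dk\,dy'\,dk'\;e^{-iy(k-p)-iy'(k'-p)}\\ &\quad\times U\!\left(x,x-\tfrac{y+y'}2\right)U\!\left(x-\tfrac{y+y'}2,x-\tfrac{y'}2\right)X_W\!\left(x-\tfrac{y'}2,k\right)U\!\left(x-\tfrac{y'}2,x+\tfrac{y-y'}2\right)\\ &\quad\times U\!\left(x+\tfrac{y-y'}2,x+\tfrac y2\right)Y_W\!\left(x+\tfrac y2,k'\right)U\!\left(x+\tfrac y2,x+\tfrac{y+y'}2\right)U\!\left(x+\tfrac{y+y'}2,x\right). \end{aligned}$$ The last integral converges absolutely on $\mathbb R^{4D}$. In the first integral the matrix element is a distribution (a delta function of $y+y'-w$); the formula means that for every sequence $\rho_m$ as above with supports shrinking to $x$ and every $v\in\mathbb C^n$, the integral with $|x\rangle$ replaced by $\rho_mv$ converges absolutely in the successive integrations over $(z,k,z',k')$, $(q,y,q',y')$ and $w$, and tends to $(X_W\bigstar Y_W)(x,p)\,v$ as $m\to\infty$. -/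

import Mathlib

open Filter Topology MeasureTheory
open scoped ContDiff SchwartzMap

noncomputable section

/-- Euclidean spacetime of dimension `D`; also momentum space. -/
abbrev Spacetime (D : ℕ) := EuclideanSpace ℝ (Fin D)

/-- The `n`-dimensional representation space of the gauge group (with possible further indices). -/
abbrev Fiber (n : ℕ) := EuclideanSpace ℂ (Fin n)

/-- Complex `n × n` matrices, as linear maps with the operator norm. -/
abbrev Mat (n : ℕ) := Fiber n →L[ℂ] Fiber n

/-- Quantum mechanical operators act on `Fiber n`-valued wave functions; the product of operators
is composition. -/
abbrev Op (D n : ℕ) := (Spacetime D → Fiber n) → (Spacetime D → Fiber n)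

/-- The phase `e^{i t}`. -/
def phase (t : ℝ) : ℂ := Complex.exp (Complex.I * (t : ℂ))

/-- `y^μ A_μ(x)`. -/
def gaugeDot {D n : ℕ} (A : Spacetime D → Fin D → Mat n) (y x : Spacetime D) : Mat n :=
  ∑ μ : Fin D, ((y μ : ℝ) : ℂ) • A x μ

/-- The factor `f_N(j) = 1 + (i/N) (w-x)^μ A_μ(x + (j/N)(w-x))`. -/
def transporterFactor {D n : ℕ} (A : Spacetime D → Fin D → Mat n) (w x : Spacetime D)
    (N j : ℕ) : Mat n :=
  1 + (Complex.I / (N : ℂ)) • gaugeDot A (w - x) (x + ((j : ℝ) / (N : ℝ)) • (w - x))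

/-- The straight-line parallel transporter `U(w,x)` from `x` to `w`:
`U(w,x) = lim_N f_N(N) f_N(N-1) ⋯ f_N(0)`. -/
def transporter {D n : ℕ} (A : Spacetime D → Fin D → Mat n) (w x : Spacetime D) : Mat n :=
  limUnder atTop (fun N : ℕ => (((List.range (N + 1)).map (transporterFactor A w x N)).reverse).prod)

/-- `u` solves `∂_t u = i y·π̂ u = y·∂u - i y·A u`, `u(0) = ψ`.  Here `i y·π̂ = y·D` with
`π̂ = p̂ - A(x̂)`, `p̂ = -i∂`, `D = ∂ - iA`.  The first order operator `∂_t - y·∂` is read as the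
directional derivative along `(1,-y)`, so that no regularity of `ψ` is needed. -/
def IsCovariantFlow {D n : ℕ} (A : Spacetime D → Fin D → Mat n) (y : Spacetime D)
    (ψ : Spacetime D → Fiber n) (u : ℝ → Spacetime D → Fiber n) : Prop :=
  u 0 = ψ ∧ ∀ (t : ℝ) (x : Spacetime D),
    HasDerivAt (fun τ : ℝ => u (t + τ) (x - τ • y)) (-(Complex.I • gaugeDot A y x (u t x))) 0

open Classical in
/-- The operator `e^{i y·π̂}`: the time-one value of the flow generated by `i y·π̂`
(for continuous `A` the flow of every `ψ` exists and is unique). -/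
def expIPi {D n : ℕ} (A : Spacetime D → Fin D → Mat n) (y : Spacetime D) : Op D n := fun ψ =>
  if h : ∃ u : ℝ → Spacetime D → Fiber n, IsCovariantFlow A y ψ u then h.choose 1 else 0

/-- The operator `e^{i q·x̂}`. -/
def expIX {D n : ℕ} (q : Spacetime D) : Op D n := fun ψ u => phase (inner ℝ q u) • ψ u

/-- A constant matrix as an operator. -/
def constOp {D n : ℕ} (a : Mat n) : Op D n := fun ψ u => a (ψ u)

/-- A sequence of test functions converging to the delta function at `c`. -/
structure IsDeltaSeq {D : ℕ} (c : Spacetime D) (ρ : ℕ → Spacetime D → ℝ) : Prop where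
  smooth : ∀ m, ContDiff ℝ ∞ (ρ m)
  compact : ∀ m, HasCompactSupport (ρ m)
  nonneg : ∀ m u, 0 ≤ ρ m u
  integral_eq_one : ∀ m, ∫ u, ρ m u = 1
  shrink : ∀ r : ℝ, 0 < r → ∀ᶠ m in atTop, Function.support (ρ m) ⊆ Metric.ball c r

/-- The wave function `ρ(u) v`; for a delta sequence at `c` it approximates the ket `|c⟩ v`. -/
def packet {D n : ℕ} (ρ : Spacetime D → ℝ) (v : Fiber n) : Spacetime D → Fiber n :=
  fun u => ((ρ u : ℝ) : ℂ) • v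

/-- `⟨x|T|x'⟩ = M`. -/
def HasMatrixElement {D n : ℕ} (T : Op D n) (x x' : Spacetime D) (M : Mat n) : Prop :=
  ∀ ρ : ℕ → Spacetime D → ℝ, IsDeltaSeq x' ρ → ∀ v : Fiber n,
    Tendsto (fun m => T (packet (ρ m) v) x) atTop (𝓝 (M v))

open Classical in
/-- The matrix element `⟨x|T|x'⟩`. -/
def matrixElement {D n : ℕ} (T : Op D n) (x x' : Spacetime D) : Mat n :=
  if h : ∃ M : Mat n, HasMatrixElement T x x' M then h.choose else 0

/-- The operator `e^{-(i/2) y·π̂} X̂ e^{-(i/2) y·π̂}`. -/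
def weylSandwich {D n : ℕ} (A : Spacetime D → Fin D → Mat n) (X : Op D n) (y : Spacetime D) :
    Op D n :=
  expIPi A (-(1 / 2 : ℝ) • y) ∘ X ∘ expIPi A (-(1 / 2 : ℝ) • y)

/-- The generalized Weyl symbol (Wigner transform)
`X_W(x,p) = ∫ dy e^{ipy} ⟨x| e^{-(i/2) yπ̂} X̂ e^{-(i/2) yπ̂} |x⟩`. -/
def weylSymbol {D n : ℕ} (A : Spacetime D → Fin D → Mat n) (X : Op D n) (x p : Spacetime D) :
    Mat n :=
  ∫ y : Spacetime D, phase (inner ℝ p y) • matrixElement (weylSandwich A X y) x x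

/-- The expression defining `X_W(x, ·)` makes sense: the matrix elements exist and the integral
converges absolutely. -/
structure WeylConverges {D n : ℕ} (A : Spacetime D → Fin D → Mat n) (X : Op D n)
    (x : Spacetime D) : Prop where
  exists_matrixElement : ∀ y, ∃ M : Mat n, HasMatrixElement (weylSandwich A X y) x x M
  integrable : Integrable (fun y : Spacetime D => matrixElement (weylSandwich A X y) x x)

/-- The integral operator with kernel `K(x,u) = ⟨x|X̂|u⟩`. -/
def kernelOp {D n : ℕ} (K : Spacetime D → Spacetime D → Mat n) : Op D n :=
  fun ψ x => ∫ u : Spacetime D, K x u (ψ u)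

/-- Operators with a continuous kernel whose Weyl symbol exists everywhere and is a Schwartz
function on phase space. -/
structure HasSchwartzSymbol {D n : ℕ} (A : Spacetime D → Fin D → Mat n) (X : Op D n) : Prop where
  kernel : ∃ K : Spacetime D → Spacetime D → Mat n,
    Continuous (Function.uncurry K) ∧ X = kernelOp K
  converges : ∀ x, WeylConverges A X x
  schwartz : ∃ σ : 𝓢(Spacetime D × Spacetime D, Mat n), ∀ x p, σ (x, p) = weylSymbol A X x p

open Classical in
/-- The generalized star product of Weyl symbols: `X_W ★ Y_W` is the Weyl symbol of `X̂ Ŷ`. -/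
def starProduct {D n : ℕ} (A : Spacetime D → Fin D → Mat n)
    (F G : Spacetime D → Spacetime D → Mat n) : Spacetime D → Spacetime D → Mat n :=
  if h : ∃ P : Op D n × Op D n, HasSchwartzSymbol A P.1 ∧ HasSchwartzSymbol A P.2 ∧
      weylSymbol A P.1 = F ∧ weylSymbol A P.2 = G then
    weylSymbol A (h.choose.1 ∘ h.choose.2)
  else 0

/-- The operator
`e^{-(i/2)wπ̂} e^{(i/2)yπ̂} e^{iqx̂} a e^{(i/2)yπ̂} e^{(i/2)y'π̂} e^{iq'x̂} b e^{(i/2)y'π̂} e^{-(i/2)wπ̂}`.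
-/
def starWord {D n : ℕ} (A : Spacetime D → Fin D → Mat n) (w q y q' y' : Spacetime D)
    (a b : Mat n) : Op D n :=
  expIPi A (-(1 / 2 : ℝ) • w) ∘ expIPi A ((1 / 2 : ℝ) • y) ∘ expIX q ∘ constOp a ∘
    expIPi A ((1 / 2 : ℝ) • y) ∘ expIPi A ((1 / 2 : ℝ) • y') ∘ expIX q' ∘ constOp b ∘
    expIPi A ((1 / 2 : ℝ) • y') ∘ expIPi A (-(1 / 2 : ℝ) • w)

/-- The integrand
`e^{-i(yk+qz+y'k'+q'z')} ⟨x| e^{-(i/2)wπ̂} ⋯ F(z,k) ⋯ G(z',k') ⋯ e^{-(i/2)wπ̂} |ψ⟩`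
as a function of `s = (z,k,z',k')`, for fixed `w` and `r = (q,y,q',y')`. -/
def starOpIntegrand {D n : ℕ} (A : Spacetime D → Fin D → Mat n)
    (F G : Spacetime D → Spacetime D → Mat n) (x : Spacetime D) (ψ : Spacetime D → Fiber n)
    (w : Spacetime D) (r s : Spacetime D × Spacetime D × Spacetime D × Spacetime D) : Fiber n :=
  match r, s with
  | (q, y, q', y'), (z, k, z', k') =>
    phase (-(inner ℝ y k + inner ℝ q z + inner ℝ y' k' + inner ℝ q' z')) •
      starWord A w q y q' y' (F z k) (G z' k') ψ x

/-- The integral of `starOpIntegrand` over `z, k, z', k'`. -/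
def starOpInner {D n : ℕ} (A : Spacetime D → Fin D → Mat n)
    (F G : Spacetime D → Spacetime D → Mat n) (x : Spacetime D) (ψ : Spacetime D → Fiber n)
    (w : Spacetime D) (r : Spacetime D × Spacetime D × Spacetime D × Spacetime D) : Fiber n :=
  ∫ s : Spacetime D × Spacetime D × Spacetime D × Spacetime D, starOpIntegrand A F G x ψ w r s

/-- The integral over `q, y, q', y'`, times `e^{ipw}`. -/
def starOpMiddle {D n : ℕ} (A : Spacetime D → Fin D → Mat n)
    (F G : Spacetime D → Spacetime D → Mat n) (x p : Spacetime D) (ψ : Spacetime D → Fiber n)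
    (w : Spacetime D) : Fiber n :=
  phase (inner ℝ p w) •
    ∫ r : Spacetime D × Spacetime D × Spacetime D × Spacetime D, starOpInner A F G x ψ w r

/-- `(2π)^{-4D} ∫ dw e^{ipw} ∫ dq dy dz dk dq' dy' dz' dk' e^{-i(yk+qz+y'k'+q'z')}`
`⟨x| e^{-(i/2)wπ̂} e^{(i/2)yπ̂} e^{iqx̂} F(z,k) ⋯ G(z',k') e^{(i/2)y'π̂} e^{-(i/2)wπ̂} |ψ⟩`. -/
def starOpIntegral {D n : ℕ} (A : Spacetime D → Fin D → Mat n)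
    (F G : Spacetime D → Spacetime D → Mat n) (x p : Spacetime D) (ψ : Spacetime D → Fiber n) :
    Fiber n :=
  ((((2 * Real.pi) ^ (4 * D))⁻¹ : ℝ) : ℂ) • ∫ w : Spacetime D, starOpMiddle A F G x p ψ w

/-- All three successive integrals in `starOpIntegral` converge absolutely. -/
structure StarOpConverges {D n : ℕ} (A : Spacetime D → Fin D → Mat n)
    (F G : Spacetime D → Spacetime D → Mat n) (x p : Spacetime D)
    (ψ : Spacetime D → Fiber n) : Prop where
  inner : ∀ w r, Integrable (starOpIntegrand A F G x ψ w r)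
  middle : ∀ w, Integrable (starOpInner A F G x ψ w)
  outer : Integrable (starOpMiddle A F G x p ψ)

/-- The integrand, as a function of `(y,k,y',k')`, of the phase-space form of the star product. -/
def starIntegrand {D n : ℕ} (A : Spacetime D → Fin D → Mat n)
    (F G : Spacetime D → Spacetime D → Mat n) (x p : Spacetime D)
    (s : Spacetime D × Spacetime D × Spacetime D × Spacetime D) : Mat n :=
  match s with
  | (y, k, y', k') =>
    phase (-inner ℝ y (k - p) - inner ℝ y' (k' - p)) •
      (transporter A x (x - (1 / 2 : ℝ) • (y + y')) *
        transporter A (x - (1 / 2 : ℝ) • (y + y')) (x - (1 / 2 : ℝ) • y') *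
        F (x - (1 / 2 : ℝ) • y') k *
        transporter A (x - (1 / 2 : ℝ) • y') (x + (1 / 2 : ℝ) • (y - y')) *
        transporter A (x + (1 / 2 : ℝ) • (y - y')) (x + (1 / 2 : ℝ) • y) *
        G (x + (1 / 2 : ℝ) • y) k' *
        transporter A (x + (1 / 2 : ℝ) • y) (x + (1 / 2 : ℝ) • (y + y')) *
        transporter A (x + (1 / 2 : ℝ) • (y + y')) x)

end

/-!
The flow of `i y·π̂` is solved by characteristics: along the line `t ↦ x - t y` the equation is a
linear ordinary differential equation with skew-adjoint coefficient, so `e^{i y·π̂}` is translation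
by `y` followed by the unitary parallel transporter, `(e^{i y·π̂} ψ)(x) = U(x, x + y) ψ(x + y)`
(`expIPi_apply`). The fundamental solution is built as a Dyson series, which is jointly continuous
in time and in the end points of the segment; the Euler products defining `U` converge to it
(`tendsto_prod_euler`, `transporter_eq`).

Hence an operator with a continuous kernel `K` has the symbol
`X_W(z, p) = ∫ dy e^{ipy} U(z, z - y/2) K(z - y/2, z + y/2) U(z + y/2, z)` (`weylSymbol_eq`). By
Fourier inversion in `p`, the kernel is recovered from the symbol (`momentumFourier_weylSymbol`), so
the operator depends only on its symbol and the star product is well defined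
(`starProduct_weylSymbol`). The inverse transform of a Schwartz symbol decays rapidly in both the
centre `z` and the difference `y`: in `z` because the symbol does, in `y` because its Fourier
transform in both variables does (`IsSchwartz.exists_bound_momentumFourier`). As `U` is unitary,
the kernels are bounded by an integrable function of each argument, uniformly in the other one;
this bound is behind every exchange of integrals.

In the phase space formula the integrals over `k` and `k'` turn the symbols and the transporters
next to them into the kernels `K(x - (y+y')/2, x + (y-y')/2)` and `L(x + (y-y')/2, x + (y+y')/2)`.
After the volume preserving substitution `w = y + y'`, `u = x + (y-y')/2`, the integral over `u` is
the kernel of the product, and the integral over `w` is its symbol (`integral_starIntegrand`).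

In the operator formula the integrals over `(z, k, z', k')` give the full Fourier transforms of the
symbols, and those over `q` and `q'` undo half of these transforms, which leaves the kernels again:
up to `(2π)^{4D}`, the inner integrals are `⟨x| e^{-(i/2)wπ̂} X̂ Ŷ e^{-(i/2)wπ̂} |ψ⟩`
(`integral_starOpInner`). For wave packets shrinking to `x` this is bounded by an integrable
function of `w` that does not depend on the packet, so dominated convergence gives the symbol
of the product (`tendsto_integral_phase_weylSandwich`).
-/

noncomputable section

/-! ### Linear ordinary differential equations with parameters -/

section LinearODE

lemma summable_dyson_bound (b c : ℝ) :
    Summable fun k : ℕ => b * (c ^ k / k.factorial) :=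
  (Real.summable_pow_div_factorial c).mul_left _

/-- On a compact set of parameters and times the coefficient is bounded, which makes the Dyson
series converge uniformly there. -/
lemma exists_coeff_bound {Λ R : Type*} [NormedRing R] [TopologicalSpace Λ] {a : Λ → ℝ → R}
    (ha : Continuous (Function.uncurry a)) {S : Set Λ} (hS : IsCompact S) (T : ℝ) :
    ∃ B, 0 ≤ B ∧ ∀ l ∈ S, ∀ s, |s| ≤ T → ‖a l s‖ ≤ B := by
  obtain ⟨C, hC⟩ := (hS.prod (isCompact_Icc (a := -T) (b := T))).exists_bound_of_continuousOn
    ha.continuousOn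
  refine ⟨max C 0, le_max_right _ _, fun l hl s hs => le_trans ?_ (le_max_left _ _)⟩
  exact hC (l, s) ⟨hl, abs_le.1 hs⟩

variable {Λ R : Type*} [NormedRing R] [NormedAlgebra ℝ R]

/-- The terms of the Dyson (time-ordered exponential) series of `a`: the iterated integrals
`∫_{0 ≤ s₁ ≤ ⋯ ≤ s_k ≤ t} a(s_k) ⋯ a(s₁)`, for a coefficient `a` depending on a parameter. -/
def dysonTerm (a : Λ → ℝ → R) : ℕ → Λ → ℝ → R
  | 0 => fun _ _ => 1
  | k + 1 => fun l t => ∫ s in (0 : ℝ)..t, a l s * dysonTerm a k l s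

/-- The sum of the Dyson series: the fundamental solution of `g' = a g` starting from `1` at time
`0`. -/
def dysonSeries (a : Λ → ℝ → R) (l : Λ) (t : ℝ) : R := ∑' k, dysonTerm a k l t

lemma continuous_dysonTerm [TopologicalSpace Λ] {a : Λ → ℝ → R}
    (ha : Continuous (Function.uncurry a)) (k : ℕ) :
    Continuous (Function.uncurry (dysonTerm a k)) := by
  induction k with
  | zero => exact continuous_const
  | succ k ih =>
    have h : Continuous (Function.uncurry fun (p : Λ × ℝ) (s : ℝ) =>
        a p.1 s * dysonTerm a k p.1 s) :=
      (ha.comp (by fun_prop : Continuous fun q : (Λ × ℝ) × ℝ => (q.1.1, q.2))).mul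
        (ih.comp (by fun_prop : Continuous fun q : (Λ × ℝ) × ℝ => (q.1.1, q.2)))
    exact intervalIntegral.continuous_parametric_intervalIntegral_of_continuous h continuous_snd

lemma norm_dysonTerm_le {a : Λ → ℝ → R} {l : Λ} {T B : ℝ} (hB : 0 ≤ B)
    (h : ∀ s, |s| ≤ T → ‖a l s‖ ≤ B) (k : ℕ) :
    ∀ t, |t| ≤ T → ‖dysonTerm a k l t‖ ≤ ‖(1 : R)‖ * ((B * |t|) ^ k / k.factorial) := by
  induction k with
  | zero => intro t _; simp [dysonTerm]
  | succ k ih =>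
    intro t ht
    have hI : ∀ᵐ s ∂(volume.restrict (Set.uIoc (0 : ℝ) t)), ‖a l s * dysonTerm a k l s‖ ≤
        ‖(1 : R)‖ * B ^ (k + 1) / k.factorial * |s - 0| ^ k := by
      refine (ae_restrict_iff' measurableSet_uIoc).2 (ae_of_all _ fun s hs => ?_)
      have hsT : |s| ≤ T := by
        refine le_trans ?_ ht
        rcases le_total 0 t with h0 | h0
        · rw [Set.uIoc_of_le h0] at hs
          rw [abs_of_pos hs.1, abs_of_nonneg h0]; exact hs.2
        · rw [Set.uIoc_of_ge h0] at hs
          rw [abs_of_nonpos hs.2, abs_of_nonpos h0]; linarith [hs.1]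
      calc ‖a l s * dysonTerm a k l s‖ ≤ ‖a l s‖ * ‖dysonTerm a k l s‖ := norm_mul_le _ _
        _ ≤ B * (‖(1 : R)‖ * ((B * |s|) ^ k / k.factorial)) :=
            mul_le_mul (h s hsT) (ih s hsT) (norm_nonneg _) hB
        _ = _ := by rw [sub_zero, mul_pow, pow_succ]; ring
    have hint : IntegrableOn (fun s : ℝ => ‖(1 : R)‖ * B ^ (k + 1) / k.factorial * |s - 0| ^ k)
        (Set.uIoc 0 t) :=
      (Continuous.integrableOn_uIoc (by fun_prop))
    have := norm_integral_le_of_norm_le hint hI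
    rw [integral_const_mul, integral_pow_abs_sub_uIoc, sub_zero] at this
    calc ‖dysonTerm a (k + 1) l t‖ = ‖∫ s in Set.uIoc (0 : ℝ) t, a l s * dysonTerm a k l s‖ :=
          intervalIntegral.norm_integral_eq_norm_integral_uIoc _
      _ ≤ _ := this
      _ = _ := by
        rw [Nat.factorial_succ, mul_pow]; push_cast
        have : (k.factorial : ℝ) ≠ 0 := by positivity
        field_simp

lemma norm_dysonTerm_le' {a : Λ → ℝ → R} {l : Λ} {T B : ℝ} (hB : 0 ≤ B)
    (h : ∀ s, |s| ≤ T → ‖a l s‖ ≤ B) (k : ℕ) (t : ℝ) (ht : |t| ≤ T) :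
    ‖dysonTerm a k l t‖ ≤ ‖(1 : R)‖ * ((B * T) ^ k / k.factorial) :=
  (norm_dysonTerm_le hB h k t ht).trans (by gcongr)

@[simp]
lemma dysonSeries_zero (a : Λ → ℝ → R) (l : Λ) : dysonSeries a l 0 = 1 := by
  unfold dysonSeries
  rw [tsum_eq_single 0]
  · rfl
  · intro k hk
    obtain ⟨j, rfl⟩ := Nat.exists_eq_succ_of_ne_zero hk
    simp [dysonTerm]

variable [CompleteSpace R]

lemma continuous_dysonSeries [TopologicalSpace Λ] [LocallyCompactSpace Λ] {a : Λ → ℝ → R}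
    (ha : Continuous (Function.uncurry a)) : Continuous (Function.uncurry (dysonSeries a)) := by
  rw [continuous_iff_continuousAt]
  rintro ⟨l, t⟩
  obtain ⟨S, hS, hlS⟩ := exists_compact_mem_nhds l
  obtain ⟨B, hB, hbd⟩ := exists_coeff_bound ha hS (|t| + 1)
  have hc : ContinuousOn (fun p : Λ × ℝ => ∑' k, dysonTerm a k p.1 p.2)
      (S ×ˢ Metric.closedBall t 1) := by
    refine continuousOn_tsum (fun k => (continuous_dysonTerm ha k).continuousOn)
      (summable_dyson_bound ‖(1 : R)‖ (B * (|t| + 1))) ?_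
    rintro k ⟨l', t'⟩ ⟨hl', ht'⟩
    refine norm_dysonTerm_le' hB (hbd l' hl') k t' ?_
    have : |t' - t| ≤ 1 := by simpa [Real.dist_eq] using ht'
    calc |t'| = |t + (t' - t)| := by ring_nf
      _ ≤ |t| + |t' - t| := abs_add_le _ _
      _ ≤ _ := by linarith
  exact hc.continuousAt (prod_mem_nhds hlS (Metric.closedBall_mem_nhds t one_pos))

lemma hasDerivAt_dysonSeries {a : Λ → ℝ → R} {l : Λ} (ha : Continuous (a l)) (t : ℝ) :
    HasDerivAt (dysonSeries a l) (a l t * dysonSeries a l t) t := by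
  -- the parameter is irrelevant here: restrict to the one-point parameter space
  set T := |t| + 1
  have hau : Continuous (Function.uncurry fun _ : Unit => a l) := ha.comp continuous_snd
  have hterm : ∀ k s, dysonTerm (fun _ : Unit => a l) k () s = dysonTerm a k l s := by
    intro k
    induction k with
    | zero => intro s; rfl
    | succ k ih => intro s; simp only [dysonTerm, ih]
  have hcont : ∀ k, Continuous (dysonTerm a k l) := by
    intro k
    have := (continuous_dysonTerm hau k).comp (by fun_prop : Continuous fun s : ℝ => ((), s))
    convert this using 1
    ext s; exact (hterm k s).symm
  obtain ⟨B, hB, hbd⟩ := exists_coeff_bound hau isCompact_univ T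
  have hbd' : ∀ s, |s| ≤ T → ‖a l s‖ ≤ B := hbd () trivial
  let g' : ℕ → ℝ → R := fun k s =>
    match k with
    | 0 => 0
    | j + 1 => a l s * dysonTerm a j l s
  have hT : ∀ s ∈ Set.Ioo (-T) T, |s| ≤ T := fun s hs => abs_le.2 ⟨hs.1.le, hs.2.le⟩
  have htm : t ∈ Set.Ioo (-T) T := abs_lt.1 (by simp [T])
  let u : ℕ → ℝ := fun k =>
    match k with
    | 0 => 0
    | j + 1 => B * (‖(1 : R)‖ * ((B * T) ^ j / j.factorial))
  have hu : Summable u :=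
    (summable_nat_add_iff 1).1 ((summable_dyson_bound ‖(1 : R)‖ (B * T)).mul_left B)
  have hsum : ∀ s, |s| ≤ T → Summable fun k => dysonTerm a k l s := fun s hs =>
    Summable.of_norm_bounded (summable_dyson_bound ‖(1 : R)‖ (B * T))
      fun k => norm_dysonTerm_le' hB hbd' k s hs
  have key := hasDerivAt_tsum_of_isPreconnected (g := fun k => dysonTerm a k l) (g' := g') hu
    isOpen_Ioo isPreconnected_Ioo (t := Set.Ioo (-T) T) (y₀ := t) (y := t) ?_ ?_ htm
    (hsum t (hT t htm)) htm
  · have hs : ∑' k, g' k t = a l t * dysonSeries a l t := by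
      have h1 : Summable fun j => a l t * dysonTerm a j l t := (hsum t (hT t htm)).mul_left _
      have h2 : Summable fun k => g' k t := (summable_nat_add_iff 1).1 h1
      rw [h2.tsum_eq_zero_add]
      simp only [g', zero_add, dysonSeries]
      exact (hsum t (hT t htm)).tsum_mul_left _
    rw [hs] at key
    exact key
  · intro k s _
    cases k with
    | zero => exact hasDerivAt_const s (1 : R)
    | succ j =>
      have hc : Continuous fun s => a l s * dysonTerm a j l s := ha.mul (hcont j)
      exact intervalIntegral.integral_hasDerivAt_right (hc.intervalIntegrable _ _)
        (hc.stronglyMeasurableAtFilter _ _) hc.continuousAt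
  · intro k s hs
    cases k with
    | zero => simp [g', u]
    | succ j =>
      calc ‖a l s * dysonTerm a j l s‖ ≤ ‖a l s‖ * ‖dysonTerm a j l s‖ := norm_mul_le _ _
        _ ≤ B * (‖(1 : R)‖ * ((B * T) ^ j / j.factorial)) :=
          mul_le_mul (hbd' s (hT s hs)) (norm_dysonTerm_le' hB hbd' j s (hT s hs))
            (norm_nonneg _) hB

end LinearODE

/-! ### The product formula for the fundamental solution -/

section ProductFormula

variable {R : Type*} [NormedRing R] [NormedAlgebra ℝ R] [CompleteSpace R]

lemma prod_range_reverse_succ {M : Type*} [Monoid M] (f : ℕ → M) (j : ℕ) :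
    ((List.range (j + 1)).map f).reverse.prod = f j * ((List.range j).map f).reverse.prod := by
  simp [List.range_succ]

/-- One step of the Euler scheme is consistent: by uniform continuity of `g'` its error is
`o(1/N)` uniformly on `[0, 1]`. -/
lemma norm_euler_step_le {g b : ℝ → R} (hg : ∀ t, HasDerivAt g (b t) t) (hb : Continuous b)
    {ε : ℝ} (hε : 0 < ε) :
    ∃ N₀ : ℕ, ∀ N : ℕ, N₀ ≤ N → 0 < N → ∀ j : ℕ, j < N →
      ‖g (((j : ℝ) + 1) / N) - g ((j : ℝ) / N) - (1 / (N : ℝ)) • b ((j : ℝ) / N)‖ ≤ ε / N := by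
  have huc := (isCompact_Icc (a := (0 : ℝ)) (b := 1)).uniformContinuousOn_of_continuous
    hb.continuousOn
  rw [Metric.uniformContinuousOn_iff] at huc
  obtain ⟨δ, hδ, h⟩ := huc ε hε
  obtain ⟨N₀, hN₀⟩ := exists_nat_gt (1 / δ)
  refine ⟨N₀, fun N hN hN0 j hj => ?_⟩
  have hNpos : (0 : ℝ) < N := by exact_mod_cast hN0
  have hNδ : 1 / (N : ℝ) < δ := by
    rw [div_lt_iff₀ hNpos]
    have : 1 / δ < N := hN₀.trans_le (by exact_mod_cast hN)
    rw [div_lt_iff₀ hδ] at this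
    linarith
  set s : ℝ := (j : ℝ) / N
  set s' : ℝ := ((j : ℝ) + 1) / N
  have hss : s' - s = 1 / N := by simp only [s, s']; ring
  have hle : s ≤ s' := by have : 0 < 1 / (N : ℝ) := by positivity
                          linarith
  have hs0 : 0 ≤ s := by positivity
  have hs1 : s' ≤ 1 := by
    rw [div_le_one hNpos]; exact_mod_cast hj
  have hint : ∫ r in s..s', (b r - b s) = g s' - g s - (1 / (N : ℝ)) • b s := by
    rw [intervalIntegral.integral_sub (hb.intervalIntegrable _ _)
      (continuous_const.intervalIntegrable _ _),
      intervalIntegral.integral_eq_sub_of_hasDerivAt (fun t _ => hg t)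
      (hb.intervalIntegrable _ _), intervalIntegral.integral_const, hss]
  rw [← hint]
  refine (intervalIntegral.norm_integral_le_of_norm_le_const (C := ε) fun r hr => ?_).trans ?_
  · rw [Set.uIoc_of_le hle] at hr
    rw [← dist_eq_norm]
    refine (h r ⟨hs0.trans hr.1.le, hr.2.trans hs1⟩ s ⟨hs0, hle.trans hs1⟩ ?_).le
    rw [Real.dist_eq, abs_of_pos (by linarith [hr.1])]
    linarith [hr.2]
  · rw [hss, abs_of_pos (by positivity)]
    apply le_of_eq; ring

/-- The ordered products `f_N(N) ⋯ f_N(0)` of the Euler factors `f_N(j) = 1 + a(j/N)/N` converge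
to the time-one value of the fundamental solution. -/
lemma tendsto_prod_euler {a g : ℝ → R} (ha : Continuous a) (hg0 : g 0 = 1)
    (hg : ∀ t, HasDerivAt g (a t * g t) t) :
    Tendsto (fun N : ℕ => ((List.range (N + 1)).map
      (fun j : ℕ => 1 + (1 / (N : ℝ)) • a ((j : ℝ) / N))).reverse.prod) atTop (𝓝 (g 1)) := by
  have hgc : Continuous g := continuous_iff_continuousAt.2 fun t => (hg t).continuousAt
  obtain ⟨B, hB⟩ := (isCompact_Icc (a := (0 : ℝ)) (b := 1)).exists_bound_of_continuousOn
    ha.continuousOn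
  have hB0 : 0 ≤ B := (norm_nonneg _).trans (hB 0 (by simp))
  set f : ℕ → ℕ → R := fun N j => 1 + (1 / (N : ℝ)) • a ((j : ℝ) / N)
  set P : ℕ → ℕ → R := fun N j => ((List.range j).map (f N)).reverse.prod
  -- the product without the last factor
  have hP : Tendsto (fun N => P N N) atTop (𝓝 (g 1)) := by
    rw [Metric.tendsto_atTop]
    intro η hη
    set ε := η / (2 * Real.exp B) with hε_def
    have hε : 0 < ε := by positivity
    obtain ⟨N₀, hN₀⟩ := norm_euler_step_le hg (ha.mul hgc) hε
    refine ⟨max N₀ 1, fun N hN => ?_⟩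
    have hN1 : 0 < N := (le_max_right _ _).trans hN
    have hNpos : (0 : ℝ) < N := by exact_mod_cast hN1
    set q : ℝ := 1 + B / N
    have hq : 1 ≤ q := by have : 0 ≤ B / N := by positivity
                          linarith
    have main : ∀ j, j ≤ N → ‖P N j - g ((j : ℝ) / N)‖ ≤ j * (ε / N) * q ^ j := by
      intro j
      induction j with
      | zero => intro _; simp [P, hg0]
      | succ j ih =>
        intro hj
        have hjN : j < N := hj
        have hmem : (j : ℝ) / N ∈ Set.Icc (0 : ℝ) 1 :=
          ⟨by positivity, by rw [div_le_one hNpos]; exact_mod_cast hjN.le⟩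
        have hstep := hN₀ N ((le_max_left _ _).trans hN) hN1 j hjN
        have e : P N (j + 1) - g (((j + 1 : ℕ) : ℝ) / N) =
            (P N j - g ((j : ℝ) / N)) +
              ((1 / (N : ℝ)) • a ((j : ℝ) / N)) * (P N j - g ((j : ℝ) / N)) -
            (g (((j : ℝ) + 1) / N) - g ((j : ℝ) / N) -
              (1 / (N : ℝ)) • (a ((j : ℝ) / N) * g ((j : ℝ) / N))) := by
          simp only [P, prod_range_reverse_succ, f]
          push_cast
          rw [add_mul, one_mul, mul_sub, smul_mul_assoc, smul_mul_assoc]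
          abel
        rw [e]
        have h1 : ‖((1 / (N : ℝ)) • a ((j : ℝ) / N)) * (P N j - g ((j : ℝ) / N))‖ ≤
            (B / N) * ‖P N j - g ((j : ℝ) / N)‖ := by
          refine (norm_mul_le _ _).trans (mul_le_mul_of_nonneg_right ?_ (norm_nonneg _))
          rw [norm_smul, Real.norm_of_nonneg (by positivity), div_mul_eq_mul_div, one_mul]
          gcongr
          exact hB _ hmem
        calc _ ≤ ‖P N j - g ((j : ℝ) / N)‖ + (B / N) * ‖P N j - g ((j : ℝ) / N)‖ + ε / N :=
              (norm_sub_le _ _).trans (add_le_add ((norm_add_le _ _).trans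
                (add_le_add le_rfl h1)) hstep)
          _ = q * ‖P N j - g ((j : ℝ) / N)‖ + ε / N := by simp only [q]; ring
          _ ≤ q * (j * (ε / N) * q ^ j) + (ε / N) * q ^ (j + 1) := by
              gcongr
              · exact ih hjN.le
              · exact le_mul_of_one_le_right (by positivity) (one_le_pow₀ hq)
          _ = _ := by push_cast; ring
    have := main N le_rfl
    rw [div_self hNpos.ne'] at this
    rw [dist_eq_norm]
    have hqe : q ^ N ≤ Real.exp B := by
      calc q ^ N ≤ (Real.exp (B / N)) ^ N := by
            gcongr
            have := Real.add_one_le_exp (B / N)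
            simp only [q]; linarith
        _ = Real.exp B := by
            rw [← Real.exp_nat_mul, mul_div_cancel₀ _ hNpos.ne']
    calc ‖P N N - g 1‖ ≤ N * (ε / N) * q ^ N := this
      _ = ε * q ^ N := by field_simp
      _ ≤ ε * Real.exp B := by gcongr
      _ = η / 2 := by rw [hε_def]; field_simp
      _ < η := by linarith
  -- the last factor tends to `1`
  have hlast : Tendsto (fun N : ℕ => f N N) atTop (𝓝 1) := by
    have h0 : Tendsto (fun N : ℕ => (1 : R) + (1 / (N : ℝ)) • a 1) atTop (𝓝 (1 + (0 : ℝ) • a 1)) :=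
      tendsto_const_nhds.add (tendsto_one_div_atTop_nhds_zero_nat.smul_const _)
    rw [zero_smul, add_zero] at h0
    refine h0.congr' ?_
    filter_upwards [eventually_gt_atTop 0] with N hN
    have : (N : ℝ) ≠ 0 := by positivity
    simp only [f, div_self this]
  have := hlast.mul hP
  rw [one_mul] at this
  refine this.congr fun N => ?_
  rw [prod_range_reverse_succ]

end ProductFormula

/-! ### The straight-line parallel transporter -/

section Transporter

variable {D n : ℕ} (A : Spacetime D → Fin D → Mat n)

/-- The coefficient `i (w - x)·A(x + s (w - x))` of the parallel transport equation along the
segment from `x` to `w`; the parameter is the pair `(w, x)`. -/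
def transportCoeff (l : Spacetime D × Spacetime D) (s : ℝ) : Mat n :=
  Complex.I • gaugeDot A (l.1 - l.2) (l.2 + s • (l.1 - l.2))

/-- The parallel transporter from `x` to `x + t (w - x)`, as a function of the end points
`(w, x)` of the segment and of `t`. -/
def partialTransporter (l : Spacetime D × Spacetime D) (t : ℝ) : Mat n :=
  dysonSeries (transportCoeff A) l t

variable {A}

lemma continuous_gaugeDot (hA : ∀ μ : Fin D, Continuous (fun x => A x μ)) :
    Continuous (fun p : Spacetime D × Spacetime D => gaugeDot A p.1 p.2) := by
  unfold gaugeDot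
  have h : ∀ μ : Fin D, Continuous fun p : Spacetime D × Spacetime D => A p.2 μ :=
    fun μ => (hA μ).comp continuous_snd
  fun_prop

lemma continuous_transportCoeff (hA : ∀ μ : Fin D, Continuous (fun x => A x μ)) :
    Continuous (Function.uncurry (transportCoeff A)) := by
  have : Continuous fun p : (Spacetime D × Spacetime D) × ℝ =>
      gaugeDot A (p.1.1 - p.1.2) (p.1.2 + p.2 • (p.1.1 - p.1.2)) :=
    (continuous_gaugeDot hA).comp (by fun_prop :
      Continuous fun p : (Spacetime D × Spacetime D) × ℝ =>
        (p.1.1 - p.1.2, p.1.2 + p.2 • (p.1.1 - p.1.2)))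
  exact this.const_smul Complex.I

lemma gaugeDot_smul (r : ℝ) (y x : Spacetime D) :
    gaugeDot A (r • y) x = r • gaugeDot A y x := by
  simp only [gaugeDot, Finset.smul_sum]
  refine Finset.sum_congr rfl fun μ _ => ?_
  rw [PiLp.smul_apply, smul_eq_mul, Complex.ofReal_mul, mul_smul]
  rfl

lemma gaugeDot_neg (y x : Spacetime D) : gaugeDot A (-y) x = -gaugeDot A y x := by
  rw [← neg_one_smul ℝ y, gaugeDot_smul]
  ext1 v
  simp

lemma isSelfAdjoint_gaugeDot (hA_herm : ∀ x μ, IsSelfAdjoint (A x μ)) (y x : Spacetime D) :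
    IsSelfAdjoint (gaugeDot A y x) := by
  unfold gaugeDot
  refine isSelfAdjoint_sum (R := Mat n) _ fun μ _ => ?_
  rw [IsSelfAdjoint, star_smul, (hA_herm x μ).star_eq]
  simp

lemma star_transportCoeff (hA_herm : ∀ x μ, IsSelfAdjoint (A x μ))
    (l : Spacetime D × Spacetime D) (s : ℝ) :
    star (transportCoeff A l s) = -transportCoeff A l s := by
  rw [transportCoeff, star_smul, (isSelfAdjoint_gaugeDot hA_herm _ _).star_eq]
  ext1 v
  simp

lemma hasDerivAt_partialTransporter (hA : ∀ μ : Fin D, Continuous (fun x => A x μ))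
    (l : Spacetime D × Spacetime D) (t : ℝ) :
    HasDerivAt (partialTransporter A l) (transportCoeff A l t * partialTransporter A l t) t :=
  hasDerivAt_dysonSeries ((continuous_transportCoeff hA).uncurry_left l) t

@[simp]
lemma partialTransporter_zero (l : Spacetime D × Spacetime D) : partialTransporter A l 0 = 1 :=
  dysonSeries_zero _ _

lemma continuous_partialTransporter (hA : ∀ μ : Fin D, Continuous (fun x => A x μ)) :
    Continuous (Function.uncurry (partialTransporter A)) :=
  continuous_dysonSeries (continuous_transportCoeff hA)

/-- The product formula: the limit defining `U(w, x)` exists and is the time-one value of the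
solution of the parallel transport equation. -/
lemma transporter_eq (hA : ∀ μ : Fin D, Continuous (fun x => A x μ)) (w x : Spacetime D) :
    transporter A w x = partialTransporter A (w, x) 1 := by
  have h := tendsto_prod_euler
    ((continuous_transportCoeff hA).uncurry_left (w, x))
    (partialTransporter_zero (w, x)) (hasDerivAt_partialTransporter hA (w, x))
  refine Tendsto.limUnder_eq (h.congr fun N => ?_)
  congr 3
  funext j
  simp only [transporterFactor, transportCoeff]
  rw [← Complex.coe_smul, smul_smul]
  congr 2
  push_cast
  ring

lemma continuous_transporter (hA : ∀ μ : Fin D, Continuous (fun x => A x μ)) :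
    Continuous (fun p : Spacetime D × Spacetime D => transporter A p.1 p.2) := by
  simp_rw [transporter_eq hA]
  exact (continuous_partialTransporter hA).comp
    (by fun_prop : Continuous fun p : Spacetime D × Spacetime D => ((p.1, p.2), (1 : ℝ)))

lemma hasDerivAt_mat_apply {M : ℝ → Mat n} {M' : Mat n} {g : ℝ → Fiber n} {g' : Fiber n} {t : ℝ}
    (hM : HasDerivAt M M' t) (hg : HasDerivAt g g' t) :
    HasDerivAt (fun t => M t (g t)) (M' (g t) + M t g') t := by
  have h := (ContinuousLinearMap.restrictScalarsL ℂ (Fiber n) (Fiber n) ℝ ℝ).hasFDerivAt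
    |>.comp_hasDerivAt t hM
  exact h.clm_apply hg

/-- Since the coefficient is skew-adjoint, `Φ* g` is constant for every solution `g` and the
fundamental solution `Φ`. -/
lemma star_partialTransporter_mul (hA : ∀ μ : Fin D, Continuous (fun x => A x μ))
    (hA_herm : ∀ x μ, IsSelfAdjoint (A x μ)) (l : Spacetime D × Spacetime D)
    {g : ℝ → Mat n} (hg : ∀ t, HasDerivAt g (transportCoeff A l t * g t) t) (t : ℝ) :
    star (partialTransporter A l t) * g t = g 0 := by
  have hd : ∀ t, HasDerivAt (fun t => star (partialTransporter A l t) * g t) 0 t := by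
    intro t
    have h := ((hasDerivAt_partialTransporter hA l t).star).mul (hg t)
    refine h.congr_deriv ?_
    rw [star_mul, star_transportCoeff hA_herm]
    ext1 v
    simp [mul_apply_eq_comp]
  have := is_const_of_deriv_eq_zero (fun t => (hd t).differentiableAt) (fun t => (hd t).deriv) t 0
  simpa using this

lemma star_partialTransporter_mul_self (hA : ∀ μ : Fin D, Continuous (fun x => A x μ))
    (hA_herm : ∀ x μ, IsSelfAdjoint (A x μ)) (l : Spacetime D × Spacetime D) (t : ℝ) :
    star (partialTransporter A l t) * partialTransporter A l t = 1 := by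
  simpa using star_partialTransporter_mul hA hA_herm l (hasDerivAt_partialTransporter hA l) t

lemma partialTransporter_mul_star_self (hA : ∀ μ : Fin D, Continuous (fun x => A x μ))
    (hA_herm : ∀ x μ, IsSelfAdjoint (A x μ)) (l : Spacetime D × Spacetime D) (t : ℝ) :
    partialTransporter A l t * star (partialTransporter A l t) = 1 := by
  have h := congrArg ContinuousLinearMap.toLinearMap
    (star_partialTransporter_mul_self hA hA_herm l t)
  ext1 v
  have h2 : (partialTransporter A l t).toLinearMap *
      (star (partialTransporter A l t)).toLinearMap = 1 := by
    rw [mul_eq_one_comm]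
    exact h
  exact congrArg (fun f : Fiber n →ₗ[ℂ] Fiber n => f v) h2

/-- Uniqueness for matrix-valued solutions of the parallel transport equation. -/
lemma eq_partialTransporter_mul (hA : ∀ μ : Fin D, Continuous (fun x => A x μ))
    (hA_herm : ∀ x μ, IsSelfAdjoint (A x μ)) (l : Spacetime D × Spacetime D)
    {g : ℝ → Mat n} (hg : ∀ t, HasDerivAt g (transportCoeff A l t * g t) t) (t : ℝ) :
    g t = partialTransporter A l t * g 0 := by
  rw [← star_partialTransporter_mul hA hA_herm l hg t, ← mul_assoc,
    partialTransporter_mul_star_self hA hA_herm, one_mul]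

/-- Uniqueness for vector-valued solutions of the parallel transport equation. -/
lemma eq_partialTransporter_apply (hA : ∀ μ : Fin D, Continuous (fun x => A x μ))
    (hA_herm : ∀ x μ, IsSelfAdjoint (A x μ)) (l : Spacetime D × Spacetime D)
    {g : ℝ → Fiber n} (hg : ∀ t, HasDerivAt g (transportCoeff A l t (g t)) t) (t : ℝ) :
    g t = partialTransporter A l t (g 0) := by
  have hd : ∀ t, HasDerivAt (fun t => star (partialTransporter A l t) (g t)) 0 t := by
    intro t
    have h := hasDerivAt_mat_apply (hasDerivAt_partialTransporter hA l t).star (hg t)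
    refine h.congr_deriv ?_
    rw [star_mul, star_transportCoeff hA_herm]
    simp
  have h0 := is_const_of_deriv_eq_zero (fun t => (hd t).differentiableAt)
    (fun t => (hd t).deriv) t 0
  simp only [partialTransporter_zero, star_one, one_apply_eq_self] at h0
  rw [← h0, ← mul_apply_eq_comp, partialTransporter_mul_star_self hA hA_herm,
    one_apply_eq_self]

lemma norm_transporter_le_one (hA : ∀ μ : Fin D, Continuous (fun x => A x μ))
    (hA_herm : ∀ x μ, IsSelfAdjoint (A x μ)) (w x : Spacetime D) :
    ‖transporter A w x‖ ≤ 1 := by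
  have h := star_partialTransporter_mul_self hA hA_herm (w, x) 1
  rw [← transporter_eq hA] at h
  have h2 := CStarRing.norm_star_mul_self (x := transporter A w x)
  have h3 : ‖(1 : Mat n)‖ ≤ 1 := ContinuousLinearMap.norm_id_le
  rw [h] at h2
  nlinarith [norm_nonneg (transporter A w x)]

/-- Transport along a part of a segment. -/
lemma transporter_lineMap (hA : ∀ μ : Fin D, Continuous (fun x => A x μ))
    (hA_herm : ∀ x μ, IsSelfAdjoint (A x μ)) (w x : Spacetime D) (s : ℝ) :
    transporter A (x + s • (w - x)) x = partialTransporter A (w, x) s := by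
  rw [transporter_eq hA]
  have h : ∀ r, HasDerivAt (fun r => partialTransporter A (w, x) (r * s))
      (transportCoeff A (x + s • (w - x), x) r * partialTransporter A (w, x) (r * s)) r := by
    intro r
    have h1 := (hasDerivAt_partialTransporter hA (w, x) (r * s)).scomp r
      ((hasDerivAt_id r).mul_const s)
    refine h1.congr_deriv ?_
    rw [one_mul, ← smul_mul_assoc]
    congr 1
    simp only [transportCoeff, add_sub_cancel_left, gaugeDot_smul, smul_smul]
    rw [smul_comm]
  have := eq_partialTransporter_mul hA hA_herm _ h 1
  simpa using this.symm

/-- Transport along a segment and back is trivial. -/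
lemma transporter_mul_symm (hA : ∀ μ : Fin D, Continuous (fun x => A x μ))
    (hA_herm : ∀ x μ, IsSelfAdjoint (A x μ)) (w x : Spacetime D) :
    transporter A w x * transporter A x w = 1 := by
  simp_rw [transporter_eq hA]
  have h : ∀ t, HasDerivAt (fun t => partialTransporter A (x, w) (1 - t))
      (transportCoeff A (w, x) t * partialTransporter A (x, w) (1 - t)) t := by
    intro t
    have h1 := (hasDerivAt_partialTransporter hA (x, w) (1 - t)).scomp t
      ((hasDerivAt_id t).const_sub 1)
    refine h1.congr_deriv ?_
    rw [← smul_mul_assoc]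
    congr 1
    simp only [transportCoeff]
    rw [← neg_sub w x, gaugeDot_neg, smul_neg, neg_smul, one_smul, neg_neg]
    congr 2
    module
  have := eq_partialTransporter_mul hA hA_herm _ h 1
  simpa using this.symm

/-- The operator `e^{i y·π̂}` is translation by `y` followed by parallel transport back. -/
lemma expIPi_apply (hA : ∀ μ : Fin D, Continuous (fun x => A x μ))
    (hA_herm : ∀ x μ, IsSelfAdjoint (A x μ)) (y : Spacetime D) (ψ : Spacetime D → Fiber n)
    (x : Spacetime D) : expIPi A y ψ x = transporter A x (x + y) (ψ (x + y)) := by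
  have hex : ∃ u : ℝ → Spacetime D → Fiber n, IsCovariantFlow A y ψ u := by
    refine ⟨fun t x => transporter A x (x + t • y) (ψ (x + t • y)), ?_, fun t x => ?_⟩
    · funext x
      simp only [zero_smul, add_zero, transporter_eq hA]
      -- a constant function solves the transport equation of a degenerate segment
      have h : ∀ t, HasDerivAt (fun _ : ℝ => (1 : Mat n)) (transportCoeff A (x, x) t * 1) t := by
        intro t
        have : transportCoeff A (x, x) t = 0 := by
          have := gaugeDot_smul (A := A) 0 (0 : Spacetime D) x
          rw [zero_smul ℝ (0 : Spacetime D), zero_smul ℝ (gaugeDot A (0 : Spacetime D) x)] at this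
          rw [transportCoeff, sub_self, smul_zero, add_zero, this]
          exact smul_zero (A := Mat n) Complex.I
        rw [this, zero_mul]
        exact hasDerivAt_const _ _
      have := eq_partialTransporter_mul hA hA_herm _ h 1
      rw [mul_one] at this
      rw [← this, one_apply_eq_self]
    · set b := x + t • y
      have e1 : ∀ τ : ℝ, x - τ • y = b + (t + τ) • ((b - y) - b) := by
        intro τ; simp only [b]; module
      have e2 : ∀ τ : ℝ, x - τ • y + (t + τ) • y = b := by
        intro τ; simp only [b]; module
      have hfun : (fun τ : ℝ => transporter A (x - τ • y) (x - τ • y + (t + τ) • y)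
          (ψ (x - τ • y + (t + τ) • y))) =
          fun τ : ℝ => partialTransporter A (b - y, b) (t + τ) (ψ b) := by
        funext τ
        rw [e2, e1, transporter_lineMap hA hA_herm]
      have hx : transporter A x b = partialTransporter A (b - y, b) t := by
        have := transporter_lineMap hA hA_herm (b - y) b t
        rw [← this]; congr 1; simp only [b]; module
      rw [hfun]
      have h1 : HasDerivAt (fun τ : ℝ => partialTransporter A (b - y, b) (t + τ))
          (transportCoeff A (b - y, b) t * partialTransporter A (b - y, b) t) 0 := by
        have := (hasDerivAt_partialTransporter hA (b - y, b) (t + 0)).scomp (0 : ℝ)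
          ((hasDerivAt_id (0 : ℝ)).const_add t)
        rw [add_zero, one_smul] at this
        exact this
      refine (hasDerivAt_mat_apply h1 (hasDerivAt_const (0 : ℝ) (ψ b))).congr_deriv ?_
      have hx' : transporter A x (x + t • y) (ψ (x + t • y)) =
          partialTransporter A (b - y, b) t (ψ b) := by rw [← hx]
      simp only [hx', map_zero, add_zero, mul_apply_eq_comp]
      have hb : b + t • (b - y - b) = x := by simp only [b]; module
      simp only [transportCoeff, hb]
      rw [sub_sub_cancel_left, gaugeDot_neg]
      simp
  rw [expIPi, dif_pos hex]
  obtain ⟨h0, hd⟩ := hex.choose_spec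
  set u := hex.choose
  set b := x + y
  have hg : ∀ t, HasDerivAt (fun t : ℝ => u t (b - t • y))
      (transportCoeff A (b - y, b) t (u t (b - t • y))) t := by
    intro t
    have h1 := hd t (b - t • y)
    have h2 : HasDerivAt (fun τ : ℝ => u (t + (τ - t)) (b - t • y - (τ - t) • y))
        (-(Complex.I • gaugeDot A y (b - t • y) (u t (b - t • y)))) t := by
      have h3 := HasDerivAt.scomp (𝕜 := ℝ) (h := fun τ : ℝ => τ - t) (h' := 1) t
        (g₁ := fun τ : ℝ => u (t + τ) (b - t • y - τ • y)) (by simpa using h1)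
        ((hasDerivAt_id t).sub_const t)
      rw [one_smul] at h3
      exact h3
    convert h2 using 1
    · funext τ
      congr 1
      · ring
      · module
    · simp only [transportCoeff]
      have hb : b + t • (b - y - b) = b - t • y := by module
      rw [hb, sub_sub_cancel_left, gaugeDot_neg]
      simp
  have := eq_partialTransporter_apply hA hA_herm _ hg 1
  simp only [one_smul, zero_smul, sub_zero, h0] at this
  have hbx : b - y = x := by simp [b]
  rw [hbx] at this
  rw [this, transporter_eq hA]

end Transporter

/-! ### Fourier inversion with the phase convention `e^{ipy}` -/

section Fourier

@[simp]
lemma norm_phase (t : ℝ) : ‖phase t‖ = 1 := by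
  rw [phase, mul_comm]; exact Complex.norm_exp_ofReal_mul_I t

lemma phase_add (s t : ℝ) : phase (s + t) = phase s * phase t := by
  simp only [phase]; rw [← Complex.exp_add]; push_cast; ring_nf

@[fun_prop]
lemma continuous_phase : Continuous phase := by
  unfold phase; fun_prop

variable {D : ℕ} {V : Type*} [NormedAddCommGroup V] [NormedSpace ℂ V]

lemma norm_phase_smul (t : ℝ) (v : V) : ‖phase t • v‖ = ‖v‖ := by
  rw [norm_smul, norm_phase, one_mul]

variable [CompleteSpace V]

lemma integral_phase_inversion {f : Spacetime D → V} (hc : Continuous f) (hf : Integrable f)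
    (hg : Integrable fun p : Spacetime D => ∫ y, phase (-inner ℝ p y) • f y) (y : Spacetime D) :
    ∫ p : Spacetime D, phase (inner ℝ p y) • ∫ y', phase (-inner ℝ p y') • f y' =
      (((2 * Real.pi) ^ D : ℝ) : ℂ) • f y := by
  have hpi : (2 * Real.pi) ≠ 0 := by positivity
  set G : Spacetime D → V := fun p => ∫ y, phase (-inner ℝ p y) • f y
  have hG : ∀ w : Spacetime D, FourierTransform.fourier f w = G ((2 * Real.pi) • w) := by
    intro w
    rw [Real.fourier_eq']
    refine integral_congr_ae (ae_of_all _ fun v => ?_)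
    simp only [phase]
    rw [real_inner_smul_left, real_inner_comm w v]
    congr 2
    push_cast
    ring
  have hFint : Integrable (FourierTransform.fourier f) := by
    have : FourierTransform.fourier f = fun w => G ((2 * Real.pi) • w) := funext hG
    rw [this]
    exact hg.comp_smul hpi
  have hinv := congrFun (hc.fourierInv_fourier_eq hf hFint) y
  rw [Real.fourierInv_eq'] at hinv
  have hs := Measure.integral_comp_smul volume (fun p => phase (inner ℝ p y) • G p) (2 * Real.pi)
  have h1 : ∫ w : Spacetime D, phase (inner ℝ ((2 * Real.pi) • w) y) • G ((2 * Real.pi) • w) =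
      f y := by
    rw [← hinv]
    refine integral_congr_ae (ae_of_all _ fun v => ?_)
    simp only [phase, hG]
    rw [real_inner_smul_left]
    congr 2
    push_cast
    ring
  rw [h1, finrank_euclideanSpace_fin, abs_of_pos (by positivity)] at hs
  rw [hs, Complex.coe_smul, smul_smul, mul_inv_cancel₀ (by positivity), one_smul]

lemma integral_phase_inversion' {f : Spacetime D → V} (hc : Continuous f) (hf : Integrable f)
    (hg : Integrable fun p : Spacetime D => ∫ y, phase (inner ℝ p y) • f y) (y : Spacetime D) :
    ∫ p : Spacetime D, phase (-inner ℝ p y) • ∫ y', phase (inner ℝ p y') • f y' =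
      (((2 * Real.pi) ^ D : ℝ) : ℂ) • f y := by
  have h := integral_phase_inversion hc hf (by simpa using hg.comp_neg) y
  rw [← h, ← integral_neg_eq_self]
  simp

end Fourier

/-! ### Schwartz functions on phase space and their Fourier transforms -/

section PhaseSpace

/-- An integrable weight, used as the standard rate of decay; `D + 1` is the least integer exponent
for which it is integrable on `ℝ^D`. -/
def decayWeight {D : ℕ} (x : Spacetime D) : ℝ := ((1 + ‖x‖) ^ (D + 1))⁻¹

variable {D : ℕ}

lemma decayWeight_pos (x : Spacetime D) : 0 < decayWeight x := by
  unfold decayWeight; positivity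

lemma decayWeight_le_one (x : Spacetime D) : decayWeight x ≤ 1 :=
  inv_le_one_of_one_le₀ (one_le_pow₀ (by linarith [norm_nonneg x]))

lemma continuous_decayWeight : Continuous (decayWeight : Spacetime D → ℝ) := by
  unfold decayWeight
  exact Continuous.inv₀ (by fun_prop) fun x => by positivity

lemma integrable_decayWeight : Integrable (decayWeight : Spacetime D → ℝ) := by
  have h := integrable_one_add_norm (E := Spacetime D) (μ := volume) (r := ((D + 1 : ℕ) : ℝ))
    (by rw [finrank_euclideanSpace_fin]; push_cast; linarith)
  refine h.congr (ae_of_all _ fun x => ?_)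
  simp only [decayWeight]
  rw [Real.rpow_neg (by positivity), Real.rpow_natCast]

lemma integrable_decayWeight_half (x : Spacetime D) :
    Integrable fun y : Spacetime D => decayWeight (x - (1 / 2 : ℝ) • y) :=
  (integrable_decayWeight.comp_sub_left x).comp_smul (by norm_num : (1 / 2 : ℝ) ≠ 0)

lemma integrable_decayWeight_half' (x : Spacetime D) :
    Integrable fun y : Spacetime D => decayWeight (x + (1 / 2 : ℝ) • y) :=
  (integrable_decayWeight.comp_add_left x).comp_smul (by norm_num : (1 / 2 : ℝ) ≠ 0)

lemma integrable_decayWeight_pow (j : ℕ) :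
    Integrable fun x : Spacetime D => decayWeight x ^ (j + 1) := by
  refine integrable_decayWeight.mono' (by
    have := continuous_decayWeight (D := D)
    fun_prop) (ae_of_all _ fun x => ?_)
  rw [Real.norm_of_nonneg (pow_nonneg (decayWeight_pos x).le _)]
  exact pow_le_of_le_one (decayWeight_pos x).le (decayWeight_le_one x) (by simp)

variable {V : Type*} [NormedAddCommGroup V] [NormedSpace ℂ V]

lemma schwartz_le_decayWeight (σ : 𝓢(Spacetime D × Spacetime D, V)) (j : ℕ) :
    ∃ C, 0 ≤ C ∧ ∀ z k, ‖σ (z, k)‖ ≤ C * (decayWeight z * decayWeight k) ^ j := by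
  set m := 2 * ((D + 1) * j)
  set C := (2 : ℝ) ^ m * ((Finset.Iic (m, 0)).sup fun m => SchwartzMap.seminorm ℝ m.1 m.2) σ
  have hC : ∀ x, (1 + ‖x‖) ^ m * ‖σ x‖ ≤ C := fun x => by
    have := SchwartzMap.one_add_le_sup_seminorm_apply (𝕜 := ℝ) (m := (m, 0)) le_rfl le_rfl σ x
    rwa [norm_iteratedFDeriv_zero] at this
  refine ⟨C, le_trans (by positivity) (hC 0), fun z k => ?_⟩
  have h1 : ((1 + ‖z‖) * (1 + ‖k‖)) ^ ((D + 1) * j) ≤ (1 + ‖(z, k)‖) ^ m := by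
    rw [pow_mul (1 + ‖(z, k)‖) 2]
    refine pow_le_pow_left₀ (by positivity) ?_ _
    rw [sq]
    exact mul_le_mul (by simp) (by simp) (by positivity) (by positivity)
  have h2 : (decayWeight z * decayWeight k) ^ j =
      (((1 + ‖z‖) * (1 + ‖k‖)) ^ ((D + 1) * j))⁻¹ := by
    rw [decayWeight, decayWeight, ← mul_inv, ← mul_pow, inv_pow, ← pow_mul]
  rw [h2, ← div_eq_mul_inv, le_div_iff₀ (by positivity), mul_comm]
  exact (mul_le_mul_of_nonneg_right h1 (norm_nonneg _)).trans (hC _)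

/-- The Fourier transform `∫ dk e^{-iyk} F(z,k)` in the momentum variable. -/
def momentumFourier (F : Spacetime D → Spacetime D → V) (z y : Spacetime D) : V :=
  ∫ k, phase (-inner ℝ y k) • F z k

/-- The Fourier transform `∫ dz dk e^{-i(yk+qz)} F(z,k)` in both phase space variables. -/
def phaseSpaceFourier (F : Spacetime D → Spacetime D → V) (q y : Spacetime D) : V :=
  ∫ s : Spacetime D × Spacetime D, phase (-(inner ℝ y s.2 + inner ℝ q s.1)) • F s.1 s.2

/-- The Fourier transform of a Schwartz function on phase space is a Schwartz function. The
product `ℝ^D × ℝ^D` carries the maximum norm, so Mathlib's Fourier transform is applied on its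
Euclidean copy `WithLp 2`. -/
lemma exists_schwartz_phaseSpaceFourier (σ : 𝓢(Spacetime D × Spacetime D, V)) :
    ∃ τ : 𝓢(Spacetime D × Spacetime D, V),
      ∀ q y, τ (q, y) = phaseSpaceFourier (fun z k => σ (z, k)) q y := by
  have hpi : (2 * Real.pi)⁻¹ ≠ 0 := by positivity
  let e := WithLp.prodContinuousLinearEquiv 2 ℝ (Spacetime D) (Spacetime D)
  let σ' := SchwartzMap.compCLMOfContinuousLinearEquiv ℝ e σ
  let sc : (Spacetime D × Spacetime D) ≃L[ℝ] (Spacetime D × Spacetime D) :=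
    (LinearEquiv.smulOfNeZero ℝ _ _ hpi).toContinuousLinearEquiv
  refine ⟨SchwartzMap.compCLMOfContinuousLinearEquiv ℝ (sc.trans e.symm)
    (FourierTransform.fourier σ'), fun q y => ?_⟩
  rw [SchwartzMap.compCLMOfContinuousLinearEquiv_apply, Function.comp_apply,
    SchwartzMap.fourier_coe, Real.fourier_eq', phaseSpaceFourier]
  rw [← (WithLp.volume_preserving_ofLp (Spacetime D) (Spacetime D)).integral_comp
    (MeasurableEquiv.toLp 2 (Spacetime D × Spacetime D)).symm.measurableEmbedding]
  refine integral_congr_ae (ae_of_all _ fun v => ?_)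
  have hsc : (sc.trans e.symm) (q, y) = (2 * Real.pi)⁻¹ • WithLp.toLp 2 (q, y) := rfl
  have hσ : σ' v = σ (WithLp.ofLp v) := rfl
  simp only [hσ, hsc, phase]
  rw [real_inner_smul_right, WithLp.prod_inner_apply]
  congr 2
  rw [real_inner_comm, real_inner_comm y]
  have : (Real.pi : ℂ) ≠ 0 := by exact_mod_cast Real.pi_ne_zero
  push_cast
  field_simp
  ring

end PhaseSpace

section SchwartzSymbol

variable {D : ℕ} {V : Type*} [NormedAddCommGroup V] [NormedSpace ℂ V]

/-- `F` is a Schwartz function on phase space, written as a function of two arguments. -/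
def IsSchwartz (F : Spacetime D → Spacetime D → V) : Prop :=
  ∃ σ : 𝓢(Spacetime D × Spacetime D, V), ∀ z k, σ (z, k) = F z k

namespace IsSchwartz

variable {F : Spacetime D → Spacetime D → V}

lemma continuous (hF : IsSchwartz F) :
    Continuous fun s : Spacetime D × Spacetime D => F s.1 s.2 := by
  obtain ⟨σ, hσ⟩ := hF
  exact σ.continuous.congr fun s => hσ s.1 s.2

lemma continuous_comp (hF : IsSchwartz F) {α : Type*} [TopologicalSpace α] {f g : α → Spacetime D}
    (hf : Continuous f) (hg : Continuous g) : Continuous fun a => F (f a) (g a) :=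
  hF.continuous.comp (hf.prodMk hg)

lemma exists_bound (hF : IsSchwartz F) (j : ℕ) :
    ∃ C, 0 ≤ C ∧ ∀ z k, ‖F z k‖ ≤ C * (decayWeight z * decayWeight k) ^ j := by
  obtain ⟨σ, hσ⟩ := hF
  obtain ⟨C, hC, h⟩ := schwartz_le_decayWeight σ j
  exact ⟨C, hC, fun z k => hσ z k ▸ h z k⟩

lemma integrable (hF : IsSchwartz F) :
    Integrable fun s : Spacetime D × Spacetime D => F s.1 s.2 := by
  obtain ⟨C, -, h⟩ := hF.exists_bound 1
  refine ((integrable_decayWeight.mul_prod integrable_decayWeight).const_mul C).mono'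
    hF.continuous.aestronglyMeasurable (ae_of_all _ fun s => ?_)
  simpa using h s.1 s.2

lemma continuous_right (hF : IsSchwartz F) (z : Spacetime D) : Continuous (F z) :=
  hF.continuous.comp (by fun_prop : Continuous fun k : Spacetime D => (z, k))

lemma integrable_right (hF : IsSchwartz F) (z : Spacetime D) : Integrable (F z) := by
  obtain ⟨C, -, h⟩ := hF.exists_bound 1
  refine (integrable_decayWeight.const_mul (C * decayWeight z)).mono'
    (hF.continuous_right z).aestronglyMeasurable (ae_of_all _ fun k => ?_)
  simpa [mul_assoc] using h z k

lemma phaseSpaceFourier (hF : IsSchwartz F) : IsSchwartz (phaseSpaceFourier F) := by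
  obtain ⟨σ, hσ⟩ := hF
  obtain ⟨τ, hτ⟩ := exists_schwartz_phaseSpaceFourier σ
  refine ⟨τ, fun q y => ?_⟩
  rw [hτ]
  congr 1
  funext z k
  exact hσ z k

lemma exists_bound_momentumFourier_left (hF : IsSchwartz F) (j : ℕ) :
    ∃ C, 0 ≤ C ∧ ∀ z y, ‖momentumFourier F z y‖ ≤ C * decayWeight z ^ (j + 1) := by
  obtain ⟨C, hC, h⟩ := hF.exists_bound (j + 1)
  refine ⟨C * ∫ k : Spacetime D, decayWeight k ^ (j + 1),
    mul_nonneg hC (integral_nonneg fun k => pow_nonneg (decayWeight_pos k).le _), fun z y => ?_⟩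
  have := norm_integral_le_of_norm_le (f := fun k => phase (-inner ℝ y k) • F z k)
    ((integrable_decayWeight_pow (D := D) j).const_mul (C * decayWeight z ^ (j + 1)))
    (ae_of_all _ fun k => by
      rw [norm_phase_smul]
      simpa [mul_pow, mul_assoc] using h z k)
  rw [integral_const_mul] at this
  calc _ ≤ _ := this
    _ = _ := by ring

lemma continuous_momentumFourier_left (hF : IsSchwartz F) (y : Spacetime D) :
    Continuous fun z => momentumFourier F z y := by
  obtain ⟨C, hC, h⟩ := hF.exists_bound 1
  have hc := hF.continuous
  refine continuous_of_dominated (bound := fun k => C * decayWeight k) (fun z => ?_)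
    (fun z => ae_of_all _ fun k => ?_) (integrable_decayWeight.const_mul C)
    (ae_of_all _ fun k => ?_)
  · have := hF.continuous_right z
    exact Continuous.aestronglyMeasurable (by fun_prop)
  · rw [norm_phase_smul]
    refine (h z k).trans ?_
    rw [pow_one]
    have := decayWeight_pos k
    exact mul_le_mul_of_nonneg_left (mul_le_of_le_one_left this.le (decayWeight_le_one z)) hC
  · exact (hc.comp (by fun_prop : Continuous fun z : Spacetime D => (z, k))).const_smul _

lemma integrable_momentumFourier_left (hF : IsSchwartz F) (y : Spacetime D) :
    Integrable fun z => momentumFourier F z y := by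
  obtain ⟨C, -, h⟩ := hF.exists_bound_momentumFourier_left 0
  refine (integrable_decayWeight.const_mul C).mono'
    (hF.continuous_momentumFourier_left y).aestronglyMeasurable (ae_of_all _ fun z => ?_)
  simpa using h z y

lemma integral_momentumFourier (hF : IsSchwartz F) (q y : Spacetime D) :
    ∫ z, phase (-inner ℝ q z) • momentumFourier F z y = _root_.phaseSpaceFourier F q y := by
  have hc := hF.continuous
  have hi : Integrable fun s : Spacetime D × Spacetime D =>
      phase (-(inner ℝ y s.2 + inner ℝ q s.1)) • F s.1 s.2 :=
    hF.integrable.mono (Continuous.aestronglyMeasurable (by fun_prop))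
      (ae_of_all _ fun s => by rw [norm_phase_smul])
  rw [_root_.phaseSpaceFourier, Measure.volume_eq_prod, integral_prod _ hi]
  refine integral_congr_ae (ae_of_all _ fun z => ?_)
  simp only [momentumFourier]
  rw [← integral_smul]
  refine integral_congr_ae (ae_of_all _ fun k => ?_)
  simp only
  rw [smul_smul, ← phase_add, neg_add, add_comm]

variable [CompleteSpace V]

/-- Fourier inversion in the first phase space variable. -/
lemma integral_phaseSpaceFourier (hF : IsSchwartz F) (z y : Spacetime D) :
    ∫ q, phase (inner ℝ q z) • _root_.phaseSpaceFourier F q y =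
      (((2 * Real.pi) ^ D : ℝ) : ℂ) • momentumFourier F z y := by
  have h := integral_phase_inversion (hF.continuous_momentumFourier_left y)
    (hF.integrable_momentumFourier_left y)
  simp_rw [hF.integral_momentumFourier] at h
  refine h ?_ z
  obtain ⟨C, -, hC⟩ := hF.phaseSpaceFourier.exists_bound 1
  refine (integrable_decayWeight.mul_const (C * decayWeight y)).mono'
    (hF.phaseSpaceFourier.continuous.comp
      (by fun_prop : Continuous fun q : Spacetime D => (q, y))).aestronglyMeasurable
    (ae_of_all _ fun q => (hC q y).trans (le_of_eq (by ring)))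

/-- The momentum Fourier transform decays rapidly in both variables. Decay in `z` is inherited
from `F`; decay in `y` is inherited from the full Fourier transform, which is Schwartz. -/
lemma exists_bound_momentumFourier (hF : IsSchwartz F) (j : ℕ) :
    ∃ C, 0 ≤ C ∧ ∀ z y, ‖momentumFourier F z y‖ ≤ C * (decayWeight z * decayWeight y) ^ j := by
  obtain ⟨C₁, hC₁, h₁⟩ := hF.exists_bound_momentumFourier_left (2 * j)
  obtain ⟨C₂, hC₂, h₂⟩ := hF.phaseSpaceFourier.exists_bound (2 * j + 1)
  have hpi : 0 < (2 * Real.pi) ^ D := by positivity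
  set I := ∫ k : Spacetime D, decayWeight k ^ (2 * j + 1)
  have hI : 0 ≤ I := integral_nonneg fun k => pow_nonneg (decayWeight_pos k).le _
  obtain ⟨C₃, hC₃⟩ : ∃ C₃, C₃ = ((2 * Real.pi) ^ D)⁻¹ * (C₂ * I) := ⟨_, rfl⟩
  have h₃ : ∀ z y, ‖momentumFourier F z y‖ ≤ C₃ * decayWeight y ^ (2 * j + 1) := by
    intro z y
    have := norm_integral_le_of_norm_le
      (f := fun q => phase (inner ℝ q z) • _root_.phaseSpaceFourier F q y)
      ((integrable_decayWeight_pow (D := D) (2 * j)).const_mul (C₂ * decayWeight y ^ (2 * j + 1)))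
      (ae_of_all _ fun q => by
        rw [norm_phase_smul]
        refine (h₂ q y).trans (le_of_eq ?_)
        rw [mul_pow]; ring)
    rw [hF.integral_phaseSpaceFourier, norm_smul, Complex.norm_real,
      Real.norm_of_nonneg hpi.le, integral_const_mul] at this
    calc ‖momentumFourier F z y‖
        = ((2 * Real.pi) ^ D)⁻¹ * ((2 * Real.pi) ^ D * ‖momentumFourier F z y‖) := by
          field_simp
      _ ≤ ((2 * Real.pi) ^ D)⁻¹ * (C₂ * decayWeight y ^ (2 * j + 1) * I) := by gcongr
      _ = _ := by rw [hC₃]; ring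
  obtain ⟨M, hM, hM₁, hM₃⟩ : ∃ M, 0 ≤ M ∧ C₁ ≤ M ∧ C₃ ≤ M :=
    ⟨max C₁ C₃, le_max_of_le_left hC₁, le_max_left _ _, le_max_right _ _⟩
  refine ⟨M, hM, fun z y => ?_⟩
  have hz := decayWeight_pos z
  have hy := decayWeight_pos y
  have hz' : decayWeight z ^ (2 * j + 1) ≤ decayWeight z ^ (2 * j) :=
    pow_le_pow_of_le_one hz.le (decayWeight_le_one z) (by simp)
  have hy' : decayWeight y ^ (2 * j + 1) ≤ decayWeight y ^ (2 * j) :=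
    pow_le_pow_of_le_one hy.le (decayWeight_le_one y) (by simp)
  have h₁' : ‖momentumFourier F z y‖ ≤ M * decayWeight z ^ (2 * j) :=
    (h₁ z y).trans (mul_le_mul hM₁ hz' (pow_nonneg hz.le _) hM)
  have h₃' : ‖momentumFourier F z y‖ ≤ M * decayWeight y ^ (2 * j) :=
    (h₃ z y).trans (mul_le_mul hM₃ hy' (pow_nonneg hy.le _) hM)
  -- the geometric mean of the two one-sided bounds
  refine (pow_le_pow_iff_left₀ (norm_nonneg _)
    (mul_nonneg hM (pow_nonneg (mul_pos hz hy).le _)) two_ne_zero).1 ?_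
  calc ‖momentumFourier F z y‖ ^ 2 = ‖momentumFourier F z y‖ * ‖momentumFourier F z y‖ := sq _
    _ ≤ (M * decayWeight z ^ (2 * j)) * (M * decayWeight y ^ (2 * j)) :=
      mul_le_mul h₁' h₃' (norm_nonneg _) (mul_nonneg hM (pow_nonneg hz.le _))
    _ = _ := by ring

end IsSchwartz

/-- Decay in the centre `z` and the difference `y` of two points gives decay in both points. -/
lemma decayWeight_center_le (z y : Spacetime D) :
    (decayWeight z * decayWeight y) ^ 2 ≤
      decayWeight (z - (1 / 2 : ℝ) • y) * decayWeight (z + (1 / 2 : ℝ) • y) := by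
  have hy : ‖(1 / 2 : ℝ) • y‖ ≤ ‖y‖ := by
    rw [norm_smul, Real.norm_of_nonneg (by norm_num)]
    linarith [norm_nonneg y]
  have key : ∀ a : Spacetime D, ‖a‖ ≤ ‖z‖ + ‖(1 / 2 : ℝ) • y‖ →
      decayWeight z * decayWeight y ≤ decayWeight a := by
    intro a ha
    rw [decayWeight, decayWeight, decayWeight, ← mul_inv, ← mul_pow]
    refine inv_anti₀ (by positivity) (pow_le_pow_left₀ (by positivity) ?_ _)
    nlinarith [norm_nonneg z, norm_nonneg y, mul_nonneg (norm_nonneg z) (norm_nonneg y)]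
  have hz := decayWeight_pos z
  have hy := decayWeight_pos y
  rw [sq]
  exact mul_le_mul (key _ (norm_sub_le _ _)) (key _ (norm_add_le _ _)) (by positivity)
    (decayWeight_pos _).le

end SchwartzSymbol

/-! ### Delta sequences and matrix elements -/

section MatrixElements

variable {D n : ℕ} {A : Spacetime D → Fin D → Mat n}

namespace IsDeltaSeq

variable {c : Spacetime D} {ρ : ℕ → Spacetime D → ℝ}

lemma integrable (hρ : IsDeltaSeq c ρ) (m : ℕ) : Integrable (ρ m) :=
  (hρ.smooth m).continuous.integrable_of_hasCompactSupport (hρ.compact m)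

lemma continuous_packet (hρ : IsDeltaSeq c ρ) (m : ℕ) (v : Fiber n) :
    Continuous (packet (ρ m) v) := by
  have := (hρ.smooth m).continuous
  unfold packet
  fun_prop

lemma hasCompactSupport_packet (hρ : IsDeltaSeq c ρ) (m : ℕ) (v : Fiber n) :
    HasCompactSupport (packet (ρ m) v) :=
  (hρ.compact m).mono' fun u hu => by
    refine subset_tsupport _ fun h => hu ?_
    simp [packet, h]

lemma norm_packet (hρ : IsDeltaSeq c ρ) (m : ℕ) (v : Fiber n) (u : Spacetime D) :
    ‖packet (ρ m) v u‖ = ρ m u * ‖v‖ := by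
  rw [packet, norm_smul, Complex.norm_real, Real.norm_of_nonneg (hρ.nonneg m u)]

lemma tendsto_integral_smul (hρ : IsDeltaSeq c ρ) {V : Type*} [NormedAddCommGroup V]
    [NormedSpace ℂ V] [CompleteSpace V] {g : Spacetime D → V} (hg : Continuous g) :
    Tendsto (fun m => ∫ u, ((ρ m u : ℝ) : ℂ) • g u) atTop (𝓝 (g c)) := by
  rw [Metric.tendsto_nhds]
  intro ε hε
  obtain ⟨r, hr, hgr⟩ := Metric.continuousAt_iff.1 (hg.continuousAt (x := c)) (ε / 2) (half_pos hε)
  filter_upwards [hρ.shrink r hr] with m hm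
  have hc := (hρ.smooth m).continuous
  have hi : Integrable fun u => ((ρ m u : ℝ) : ℂ) • g u :=
    Continuous.integrable_of_hasCompactSupport (by fun_prop)
      ((hρ.compact m).mono' fun u hu => subset_tsupport _ fun h => hu (by simp [h]))
  have hi' : Integrable fun u => ((ρ m u : ℝ) : ℂ) • g c := (hρ.integrable m).ofReal.smul_const _
  have h1 : ∫ u, ((ρ m u : ℝ) : ℂ) • g c = g c := by
    rw [integral_smul_const, integral_complex_ofReal, hρ.integral_eq_one, Complex.ofReal_one,
      one_smul]
  rw [dist_eq_norm]
  rw [← h1, ← integral_sub hi hi']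
  calc ‖∫ u, (((ρ m u : ℝ) : ℂ) • g u - ((ρ m u : ℝ) : ℂ) • g c)‖ ≤ ∫ u, ρ m u * (ε / 2) := by
        refine norm_integral_le_of_norm_le ((hρ.integrable m).mul_const _) (ae_of_all _ fun u => ?_)
        rw [← smul_sub, norm_smul, Complex.norm_real, Real.norm_of_nonneg (hρ.nonneg m u)]
        by_cases hu : ρ m u = 0
        · simp [hu]
        · refine mul_le_mul_of_nonneg_left ?_ (hρ.nonneg m u)
          rw [← dist_eq_norm]
          exact (hgr (hm hu)).le
    _ = ε / 2 := by rw [integral_mul_const, hρ.integral_eq_one, one_mul]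
    _ < ε := half_lt_self hε

end IsDeltaSeq

lemma exists_isDeltaSeq (c : Spacetime D) : ∃ ρ, IsDeltaSeq c ρ := by
  let f : ℕ → ContDiffBump c := fun m =>
    { rIn := 1 / (2 * ((m : ℝ) + 1)), rOut := 1 / ((m : ℝ) + 1), rIn_pos := by positivity
      rIn_lt_rOut := one_div_lt_one_div_of_lt (by positivity)
        (by have : (0 : ℝ) ≤ m := m.cast_nonneg
            linarith) }
  refine ⟨fun m => (f m).normed volume, fun m => (f m).contDiff_normed,
    fun m => (f m).hasCompactSupport_normed, fun m u => (f m).nonneg_normed u,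
    fun m => (f m).integral_normed, fun r hr => ?_⟩
  filter_upwards [tendsto_one_div_add_atTop_nhds_zero_nat.eventually_lt_const hr] with m hm
  rw [(f m).support_normed_eq]
  exact Metric.ball_subset_ball hm.le

lemma HasMatrixElement.unique {T : Op D n} {x x' : Spacetime D} {M M' : Mat n}
    (h : HasMatrixElement T x x' M) (h' : HasMatrixElement T x x' M') : M = M' := by
  obtain ⟨ρ, hρ⟩ := exists_isDeltaSeq x'
  ext1 v
  exact tendsto_nhds_unique (h ρ hρ v) (h' ρ hρ v)

lemma HasMatrixElement.matrixElement_eq {T : Op D n} {x x' : Spacetime D} {M : Mat n}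
    (h : HasMatrixElement T x x' M) : matrixElement T x x' = M := by
  have hex : ∃ M, HasMatrixElement T x x' M := ⟨M, h⟩
  rw [matrixElement, dif_pos hex]
  exact hex.choose_spec.unique h

/-- `T` acts on continuous wave functions with compact support as the integral operator with the
continuous kernel `K`. -/
structure HasKernel (T : Op D n) (K : Spacetime D → Spacetime D → Mat n) : Prop where
  continuous : Continuous fun p : Spacetime D × Spacetime D => K p.1 p.2
  apply : ∀ ψ : Spacetime D → Fiber n, Continuous ψ → HasCompactSupport ψ → T ψ = kernelOp K ψ

/-- The kernel `⟨z|e^{-(i/2)yπ̂} T e^{-(i/2)yπ̂}|z⟩`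
`= U(z, z - y/2) K(z - y/2, z + y/2) U(z + y/2, z)`, as a function of the centre `z` and the
difference `y`. -/
def wignerKernel (A : Spacetime D → Fin D → Mat n) (K : Spacetime D → Spacetime D → Mat n)
    (z y : Spacetime D) : Mat n :=
  transporter A z (z - (1 / 2 : ℝ) • y) * K (z - (1 / 2 : ℝ) • y) (z + (1 / 2 : ℝ) • y) *
    transporter A (z + (1 / 2 : ℝ) • y) z

section

variable (hA : ∀ μ : Fin D, Continuous (fun x => A x μ))

include hA

lemma continuous_transporter_comp {α : Type*} [TopologicalSpace α] {f g : α → Spacetime D}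
    (hf : Continuous f) (hg : Continuous g) : Continuous fun a => transporter A (f a) (g a) := by
  have h := (continuous_transporter hA).comp (hf.prodMk hg)
  exact h

lemma continuous_wignerKernel {K : Spacetime D → Spacetime D → Mat n}
    (hK : Continuous fun p : Spacetime D × Spacetime D => K p.1 p.2) :
    Continuous fun p : Spacetime D × Spacetime D => wignerKernel A K p.1 p.2 := by
  unfold wignerKernel
  refine Continuous.mul (Continuous.mul ?_ ?_) ?_
  · exact continuous_transporter_comp hA (by fun_prop) (by fun_prop)
  · exact hK.comp (by fun_prop : Continuous fun p : Spacetime D × Spacetime D =>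
      (p.1 - (1 / 2 : ℝ) • p.2, p.1 + (1 / 2 : ℝ) • p.2))
  · exact continuous_transporter_comp hA (by fun_prop) (by fun_prop)

variable (hA_herm : ∀ x μ, IsSelfAdjoint (A x μ))

include hA_herm

/-- The kernel is recovered from its covariant form by undoing the parallel transport. -/
lemma kernel_eq_wignerKernel (K : Spacetime D → Spacetime D → Mat n) (z y : Spacetime D) :
    K (z - (1 / 2 : ℝ) • y) (z + (1 / 2 : ℝ) • y) =
      transporter A (z - (1 / 2 : ℝ) • y) z * wignerKernel A K z y *
        transporter A z (z + (1 / 2 : ℝ) • y) := by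
  have h1 := transporter_mul_symm hA hA_herm (z - (1 / 2 : ℝ) • y) z
  have h2 := transporter_mul_symm hA hA_herm (z + (1 / 2 : ℝ) • y) z
  rw [wignerKernel, mul_assoc (transporter A z _), ← mul_assoc, h1, one_mul, mul_assoc, h2, mul_one]

lemma continuous_expIPi (y : Spacetime D) {ψ : Spacetime D → Fiber n} (hψ : Continuous ψ) :
    Continuous (expIPi A y ψ) := by
  have : expIPi A y ψ = fun x => transporter A x (x + y) (ψ (x + y)) :=
    funext fun x => expIPi_apply hA hA_herm y ψ x
  rw [this]
  exact (continuous_transporter_comp hA (by fun_prop) (by fun_prop)).clm_apply (by fun_prop)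

lemma hasCompactSupport_expIPi (y : Spacetime D) {ψ : Spacetime D → Fiber n}
    (hψ : HasCompactSupport ψ) : HasCompactSupport (expIPi A y ψ) := by
  have h := hψ.comp_homeomorph (Homeomorph.addRight y)
  refine h.mono' fun u hu => subset_tsupport _ fun h0 => hu ?_
  have h0' : ψ (u + y) = 0 := h0
  rw [expIPi_apply hA hA_herm, h0', map_zero]

/-- The substitution `u = t + y/2` in the kernel integral moves both translations to the kernel. -/
lemma weylSandwich_apply {T : Op D n} {K : Spacetime D → Spacetime D → Mat n}
    (hT : HasKernel T K) (y : Spacetime D) {ψ : Spacetime D → Fiber n} (hψ : Continuous ψ)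
    (hψc : HasCompactSupport ψ) (x : Spacetime D) :
    weylSandwich A T y ψ x = transporter A x (x - (1 / 2 : ℝ) • y)
      (∫ t, K (x - (1 / 2 : ℝ) • y) (t + (1 / 2 : ℝ) • y)
        (transporter A (t + (1 / 2 : ℝ) • y) t (ψ t))) := by
  have e : ∀ u : Spacetime D, u + -(1 / 2 : ℝ) • y = u - (1 / 2 : ℝ) • y := fun u => by module
  simp only [weylSandwich, Function.comp_apply]
  rw [expIPi_apply hA hA_herm, hT.apply _ (continuous_expIPi hA hA_herm _ hψ)
    (hasCompactSupport_expIPi hA hA_herm _ hψc), kernelOp, e]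
  congr 1
  rw [← integral_add_right_eq_self _ ((1 / 2 : ℝ) • y)]
  refine integral_congr_ae (ae_of_all _ fun t => ?_)
  simp only
  rw [expIPi_apply hA hA_herm, e, add_sub_cancel_right]

lemma hasMatrixElement_weylSandwich {T : Op D n} {K : Spacetime D → Spacetime D → Mat n}
    (hT : HasKernel T K) (y x : Spacetime D) :
    HasMatrixElement (weylSandwich A T y) x x (wignerKernel A K x y) := by
  intro ρ hρ v
  have hg : Continuous fun t => K (x - (1 / 2 : ℝ) • y) (t + (1 / 2 : ℝ) • y)
      (transporter A (t + (1 / 2 : ℝ) • y) t v) :=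
    (hT.continuous.comp (by fun_prop : Continuous fun t : Spacetime D =>
      (x - (1 / 2 : ℝ) • y, t + (1 / 2 : ℝ) • y))).clm_apply
      ((continuous_transporter_comp hA (by fun_prop) (by fun_prop)).clm_apply continuous_const)
  have h := ((transporter A x (x - (1 / 2 : ℝ) • y)).continuous.tendsto _).comp
    (hρ.tendsto_integral_smul hg)
  refine h.congr fun m => ?_
  rw [weylSandwich_apply hA hA_herm hT y (hρ.continuous_packet m v)
    (hρ.hasCompactSupport_packet m v)]
  simp only [Function.comp_apply, packet, map_smul]

lemma matrixElement_weylSandwich {T : Op D n} {K : Spacetime D → Spacetime D → Mat n}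
    (hT : HasKernel T K) (y x : Spacetime D) :
    matrixElement (weylSandwich A T y) x x = wignerKernel A K x y :=
  (hasMatrixElement_weylSandwich hA hA_herm hT y x).matrixElement_eq

lemma weylSymbol_eq {T : Op D n} {K : Spacetime D → Spacetime D → Mat n}
    (hT : HasKernel T K) (x p : Spacetime D) :
    weylSymbol A T x p = ∫ y : Spacetime D, phase (inner ℝ p y) • wignerKernel A K x y := by
  simp only [weylSymbol, matrixElement_weylSandwich hA hA_herm hT]

lemma weylConverges_iff {T : Op D n} {K : Spacetime D → Spacetime D → Mat n}
    (hT : HasKernel T K) (x : Spacetime D) :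
    WeylConverges A T x ↔ Integrable fun y => wignerKernel A K x y := by
  simp only [← matrixElement_weylSandwich hA hA_herm hT]
  exact ⟨fun h => h.integrable,
    fun h => ⟨fun y => ⟨_, hasMatrixElement_weylSandwich hA hA_herm hT y x⟩, h⟩⟩

end

end MatrixElements

/-! ### Operators with Schwartz symbols -/

section Kernels

variable {D n : ℕ} {A : Spacetime D → Fin D → Mat n}

lemma hasKernel_kernelOp {K : Spacetime D → Spacetime D → Mat n}
    (hK : Continuous (Function.uncurry K)) : HasKernel (kernelOp K) K :=
  ⟨hK, fun _ _ _ => rfl⟩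

/-- The kernel is continuous and decays in both variables. -/
structure IsDecayingKernel (K : Spacetime D → Spacetime D → Mat n) : Prop where
  continuous : Continuous fun p : Spacetime D × Spacetime D => K p.1 p.2
  bound : ∃ C, 0 ≤ C ∧ ∀ a b, ‖K a b‖ ≤ C * (decayWeight a * decayWeight b)

/-- The kernel of a product of integral operators. -/
def prodKernel (K L : Spacetime D → Spacetime D → Mat n) (a b : Spacetime D) : Mat n :=
  ∫ u, K a u * L u b

lemma norm_mul_mul_le {a b c d : ℝ} {P Q : Mat n} (hP : ‖P‖ ≤ a * b) (hQ : ‖Q‖ ≤ c * d) :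
    ‖P * Q‖ ≤ a * b * (c * d) :=
  (norm_mul_le _ _).trans (mul_le_mul hP hQ (norm_nonneg _) ((norm_nonneg _).trans hP))

lemma IsDecayingKernel.exists_bound_mul {K L : Spacetime D → Spacetime D → Mat n}
    (hK : IsDecayingKernel K) (hL : IsDecayingKernel L) :
    ∃ C, 0 ≤ C ∧ ∀ a u b, ‖K a u * L u b‖ ≤
      C * (decayWeight a * decayWeight b) * decayWeight u := by
  obtain ⟨C₁, h₁, hb₁⟩ := hK.bound
  obtain ⟨C₂, h₂, hb₂⟩ := hL.bound
  refine ⟨C₁ * C₂, mul_nonneg h₁ h₂, fun a u b => (norm_mul_mul_le (hb₁ a u) (hb₂ u b)).trans ?_⟩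
  have ha := decayWeight_pos a
  have hb := decayWeight_pos b
  have hu := decayWeight_pos u
  have hu1 := decayWeight_le_one u
  have : 0 ≤ C₁ * C₂ * (decayWeight a * decayWeight b) * decayWeight u := by positivity
  calc _ = C₁ * C₂ * (decayWeight a * decayWeight b) * decayWeight u * decayWeight u := by ring
    _ ≤ _ := mul_le_of_le_one_right this hu1

lemma IsDecayingKernel.prodKernel {K L : Spacetime D → Spacetime D → Mat n}
    (hK : IsDecayingKernel K) (hL : IsDecayingKernel L) : IsDecayingKernel (prodKernel K L) := by
  obtain ⟨C, hC, hb⟩ := hK.exists_bound_mul hL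
  have hKc := hK.continuous
  have hLc := hL.continuous
  refine ⟨?_, C * ∫ u : Spacetime D, decayWeight u,
    mul_nonneg hC (integral_nonneg fun u => (decayWeight_pos u).le), fun a b => ?_⟩
  · refine continuous_of_dominated (bound := fun u => C * decayWeight u) (fun p => ?_)
      (fun p => ae_of_all _ fun u => (hb _ _ _).trans ?_) (integrable_decayWeight.const_mul C)
      (ae_of_all _ fun u => ?_)
    · refine Continuous.aestronglyMeasurable (Continuous.mul ?_ ?_)
      · exact hKc.comp (by fun_prop : Continuous fun u : Spacetime D => (p.1, u))
      · exact hLc.comp (by fun_prop : Continuous fun u : Spacetime D => (u, p.2))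
    · have h1 := decayWeight_pos p.1
      have h2 := decayWeight_pos p.2
      have : decayWeight p.1 * decayWeight p.2 ≤ 1 :=
        mul_le_one₀ (decayWeight_le_one _) h2.le (decayWeight_le_one _)
      exact mul_le_mul_of_nonneg_right (mul_le_of_le_one_right hC this) (decayWeight_pos u).le
    · refine Continuous.mul ?_ ?_
      · exact hKc.comp (by fun_prop : Continuous fun p : Spacetime D × Spacetime D => (p.1, u))
      · exact hLc.comp (by fun_prop : Continuous fun p : Spacetime D × Spacetime D => (u, p.2))
  · have := norm_integral_le_of_norm_le
      (integrable_decayWeight.const_mul (C * (decayWeight a * decayWeight b)))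
      (ae_of_all _ fun u => hb a u b)
    rw [integral_const_mul] at this
    calc _ ≤ _ := this
      _ = _ := by ring

lemma IsDecayingKernel.integrable_mul_apply {K L : Spacetime D → Spacetime D → Mat n}
    (hK : IsDecayingKernel K) (hL : IsDecayingKernel L) {ψ : Spacetime D → Fiber n}
    (hψ : Continuous ψ) (hψc : HasCompactSupport ψ) (a : Spacetime D) :
    Integrable fun q : Spacetime D × Spacetime D => (K a q.1 * L q.1 q.2) (ψ q.2) := by
  obtain ⟨C, hC, hb⟩ := hK.exists_bound_mul hL
  have hψi : Integrable ψ := hψ.integrable_of_hasCompactSupport hψc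
  refine ((integrable_decayWeight.mul_prod hψi.norm).const_mul C).mono' ?_
    (ae_of_all _ fun q => ?_)
  · refine Continuous.aestronglyMeasurable (Continuous.clm_apply (Continuous.mul ?_ hL.continuous)
      (by fun_prop))
    exact hK.continuous.comp
      (by fun_prop : Continuous fun q : Spacetime D × Spacetime D => (a, q.1))
  · refine (ContinuousLinearMap.le_opNorm _ _).trans ?_
    rw [← mul_assoc]
    refine mul_le_mul_of_nonneg_right ((hb a q.1 q.2).trans ?_) (norm_nonneg _)
    refine mul_le_mul_of_nonneg_right ?_ (decayWeight_pos _).le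
    exact mul_le_of_le_one_right hC (mul_le_one₀ (decayWeight_le_one _) (decayWeight_pos _).le
      (decayWeight_le_one _))

lemma IsDecayingKernel.integrable_mul {K L : Spacetime D → Spacetime D → Mat n}
    (hK : IsDecayingKernel K) (hL : IsDecayingKernel L) (a b : Spacetime D) :
    Integrable fun u => K a u * L u b := by
  obtain ⟨C, hC, hb⟩ := hK.exists_bound_mul hL
  refine (integrable_decayWeight.const_mul (C * (decayWeight a * decayWeight b))).mono' ?_
    (ae_of_all _ fun u => hb a u b)
  refine Continuous.aestronglyMeasurable (Continuous.mul ?_ ?_)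
  · exact hK.continuous.comp (by fun_prop : Continuous fun u : Spacetime D => (a, u))
  · exact hL.continuous.comp (by fun_prop : Continuous fun u : Spacetime D => (u, b))

lemma IsDecayingKernel.integral_mul_apply {K L : Spacetime D → Spacetime D → Mat n}
    (hK : IsDecayingKernel K) (hL : IsDecayingKernel L) {ψ : Spacetime D → Fiber n}
    (hψ : Continuous ψ) (hψc : HasCompactSupport ψ) (a : Spacetime D) :
    ∫ q : Spacetime D × Spacetime D, (K a q.1 * L q.1 q.2) (ψ q.2) =
      kernelOp (_root_.prodKernel K L) ψ a := by
  rw [Measure.volume_eq_prod, integral_prod_symm _ (hK.integrable_mul_apply hL hψ hψc a)]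
  refine integral_congr_ae (ae_of_all _ fun b => ?_)
  exact (ContinuousLinearMap.integral_apply (hK.integrable_mul hL a b) (ψ b)).symm

/-- The product of two integral operators is the integral operator with the product kernel. -/
lemma IsDecayingKernel.hasKernel_comp {K L : Spacetime D → Spacetime D → Mat n}
    (hK : IsDecayingKernel K) (hL : IsDecayingKernel L) :
    HasKernel (kernelOp K ∘ kernelOp L) (_root_.prodKernel K L) := by
  refine ⟨(hK.prodKernel hL).continuous, fun ψ hψ hψc => ?_⟩
  have hψi : Integrable ψ := hψ.integrable_of_hasCompactSupport hψc
  have hL1 : ∀ u, Integrable fun b => L u b (ψ b) := by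
    intro u
    obtain ⟨C', hC', hb'⟩ := hL.bound
    refine (hψi.norm.const_mul C').mono' ?_ (ae_of_all _ fun b => ?_)
    · exact Continuous.aestronglyMeasurable (Continuous.clm_apply
        (hL.continuous.comp (by fun_prop : Continuous fun b : Spacetime D => (u, b))) hψ)
    · refine (ContinuousLinearMap.le_opNorm _ _).trans
        (mul_le_mul_of_nonneg_right ((hb' u b).trans ?_) (norm_nonneg _))
      exact mul_le_of_le_one_right hC' (mul_le_one₀ (decayWeight_le_one _) (decayWeight_pos _).le
        (decayWeight_le_one _))
  funext a
  rw [← hK.integral_mul_apply hL hψ hψc, Measure.volume_eq_prod,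
    integral_prod _ (hK.integrable_mul_apply hL hψ hψc a)]
  refine integral_congr_ae (ae_of_all _ fun u => ?_)
  exact ((K a u).integral_comp_comm (hL1 u)).symm

variable (hA : ∀ μ : Fin D, Continuous (fun x => A x μ))
  (hA_herm : ∀ x μ, IsSelfAdjoint (A x μ))

include hA hA_herm

lemma norm_wignerKernel_le (K : Spacetime D → Spacetime D → Mat n) (z y : Spacetime D) :
    ‖wignerKernel A K z y‖ ≤ ‖K (z - (1 / 2 : ℝ) • y) (z + (1 / 2 : ℝ) • y)‖ := by
  have h1 := norm_transporter_le_one hA hA_herm z (z - (1 / 2 : ℝ) • y)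
  have h2 := norm_transporter_le_one hA hA_herm (z + (1 / 2 : ℝ) • y) z
  refine (norm_mul_le _ _).trans ((mul_le_of_le_one_right (norm_nonneg _) h2).trans ?_)
  exact (norm_mul_le _ _).trans (mul_le_of_le_one_left (norm_nonneg _) h1)

/-- Fourier inversion in the momentum: the covariant kernel is determined by the symbol. -/
lemma momentumFourier_weylSymbol {X : Op D n} (hX : HasSchwartzSymbol A X)
    {K : Spacetime D → Spacetime D → Mat n} (hK : HasKernel X K) (z y : Spacetime D) :
    momentumFourier (weylSymbol A X) z y =
      (((2 * Real.pi) ^ D : ℝ) : ℂ) • wignerKernel A K z y := by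
  have hS : IsSchwartz (weylSymbol A X) := hX.schwartz
  have hint := (weylConverges_iff hA hA_herm hK z).1 (hX.converges z)
  have hc : Continuous (wignerKernel A K z) :=
    (continuous_wignerKernel hA hK.continuous).uncurry_left z
  have hi := hS.integrable_right z
  have he : weylSymbol A X z =
      fun p => ∫ y : Spacetime D, phase (inner ℝ p y) • wignerKernel A K z y :=
    funext fun p => weylSymbol_eq hA hA_herm hK z p
  rw [he] at hi
  have h := integral_phase_inversion' hc hint hi y
  rw [← h, momentumFourier]
  refine integral_congr_ae (ae_of_all _ fun p => ?_)
  simp only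
  rw [weylSymbol_eq hA hA_herm hK, real_inner_comm]

lemma HasSchwartzSymbol.wignerKernel_eq {X : Op D n} (hX : HasSchwartzSymbol A X)
    {K : Spacetime D → Spacetime D → Mat n} (hK : HasKernel X K) (z y : Spacetime D) :
    wignerKernel A K z y =
      ((((2 * Real.pi) ^ D)⁻¹ : ℝ) : ℂ) • momentumFourier (weylSymbol A X) z y := by
  rw [momentumFourier_weylSymbol hA hA_herm hX hK, smul_smul, ← Complex.ofReal_mul,
    inv_mul_cancel₀ (by positivity), Complex.ofReal_one, one_smul]

lemma HasSchwartzSymbol.isDecayingKernel {X : Op D n} (hX : HasSchwartzSymbol A X)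
    {K : Spacetime D → Spacetime D → Mat n} (hK : HasKernel X K) : IsDecayingKernel K := by
  have hS : IsSchwartz (weylSymbol A X) := hX.schwartz
  obtain ⟨C, hC, hb⟩ := hS.exists_bound_momentumFourier 2
  have hpi : 0 ≤ ((2 * Real.pi) ^ D)⁻¹ := by positivity
  refine ⟨hK.continuous, ((2 * Real.pi) ^ D)⁻¹ * C, mul_nonneg hpi hC, fun a b => ?_⟩
  obtain ⟨z, y, rfl, rfl⟩ : ∃ z y : Spacetime D,
      a = z - (1 / 2 : ℝ) • y ∧ b = z + (1 / 2 : ℝ) • y :=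
    ⟨(1 / 2 : ℝ) • (a + b), b - a, by module, by module⟩
  have h1 := norm_transporter_le_one hA hA_herm (z - (1 / 2 : ℝ) • y) z
  have h2 := norm_transporter_le_one hA hA_herm z (z + (1 / 2 : ℝ) • y)
  rw [kernel_eq_wignerKernel hA hA_herm K z y]
  refine (norm_mul_le _ _).trans ((mul_le_of_le_one_right (norm_nonneg _) h2).trans ?_)
  refine (norm_mul_le _ _).trans ((mul_le_of_le_one_left (norm_nonneg _) h1).trans ?_)
  rw [hX.wignerKernel_eq hA hA_herm hK, norm_smul, Complex.norm_real, Real.norm_of_nonneg hpi,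
    mul_assoc]
  refine mul_le_mul_of_nonneg_left ((hb z y).trans ?_) hpi
  exact mul_le_mul_of_nonneg_left (decayWeight_center_le z y) hC

/-- An operator with a continuous kernel and a Schwartz symbol is determined by its symbol. -/
lemma HasSchwartzSymbol.eq_of_weylSymbol_eq {X X' : Op D n} (hX : HasSchwartzSymbol A X)
    (hX' : HasSchwartzSymbol A X') (h : weylSymbol A X = weylSymbol A X') : X = X' := by
  obtain ⟨K, hK, rfl⟩ := hX.kernel
  obtain ⟨K', hK', rfl⟩ := hX'.kernel
  have hKK : K = K' := by
    funext a b
    obtain ⟨z, y, rfl, rfl⟩ : ∃ z y : Spacetime D,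
        a = z - (1 / 2 : ℝ) • y ∧ b = z + (1 / 2 : ℝ) • y :=
      ⟨(1 / 2 : ℝ) • (a + b), b - a, by module, by module⟩
    rw [kernel_eq_wignerKernel hA hA_herm K z y, kernel_eq_wignerKernel hA hA_herm K' z y,
      hX.wignerKernel_eq hA hA_herm (hasKernel_kernelOp hK),
      hX'.wignerKernel_eq hA hA_herm (hasKernel_kernelOp hK'), h]
  rw [hKK]

lemma starProduct_weylSymbol {X Y : Op D n} (hX : HasSchwartzSymbol A X)
    (hY : HasSchwartzSymbol A Y) :
    starProduct A (weylSymbol A X) (weylSymbol A Y) = weylSymbol A (X ∘ Y) := by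
  have hex : ∃ P : Op D n × Op D n, HasSchwartzSymbol A P.1 ∧ HasSchwartzSymbol A P.2 ∧
      weylSymbol A P.1 = weylSymbol A X ∧ weylSymbol A P.2 = weylSymbol A Y :=
    ⟨(X, Y), hX, hY, rfl, rfl⟩
  rw [starProduct, dif_pos hex]
  obtain ⟨h1, h2, e1, e2⟩ := hex.choose_spec
  rw [h1.eq_of_weylSymbol_eq hA hA_herm hX e1, h2.eq_of_weylSymbol_eq hA hA_herm hY e2]

lemma IsDecayingKernel.integrable_wignerKernel {K : Spacetime D → Spacetime D → Mat n}
    (hK : IsDecayingKernel K) (x : Spacetime D) : Integrable fun y => wignerKernel A K x y := by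
  obtain ⟨C, hC, hb⟩ := hK.bound
  have hi : Integrable fun y : Spacetime D => C * decayWeight (x - (1 / 2 : ℝ) • y) :=
    (integrable_decayWeight_half x).const_mul C
  refine hi.mono' ((continuous_wignerKernel hA hK.continuous).comp
    (by fun_prop : Continuous fun y : Spacetime D => (x, y))).aestronglyMeasurable
    (ae_of_all _ fun y => (norm_wignerKernel_le hA hA_herm K x y).trans ((hb _ _).trans ?_))
  exact mul_le_mul_of_nonneg_left
    (mul_le_of_le_one_right (decayWeight_pos _).le (decayWeight_le_one _)) hC

end Kernels

/-! ### Integrals over products -/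

section ProductIntegrals

/-- The regrouping `((a, c), (b, d)) ↦ (a, b, c, d)`, used to integrate over two of four variables
first. -/
lemma measurePreserving_prodProdProdComm {α β γ δ : Type*} [MeasureSpace α] [MeasureSpace β]
    [MeasureSpace γ] [MeasureSpace δ] [SFinite (volume : Measure α)] [SFinite (volume : Measure β)]
    [SFinite (volume : Measure γ)] [SFinite (volume : Measure δ)] :
    ∃ e : (α × γ) × (β × δ) ≃ᵐ α × β × γ × δ, MeasurePreserving e ∧
      ∀ a b, e (a, b) = (a.1, b.1, a.2, b.2) := by
  let e₁ : γ × β × δ ≃ᵐ β × γ × δ := (MeasurableEquiv.prodAssoc.symm.trans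
    (MeasurableEquiv.prodCongr MeasurableEquiv.prodComm (MeasurableEquiv.refl δ))).trans
      MeasurableEquiv.prodAssoc
  have h₁ : MeasurePreserving e₁ := by
    refine MeasurePreserving.trans (MeasurePreserving.trans
      (MeasurePreserving.symm _ (measurePreserving_prodAssoc volume volume volume)) ?_)
      (measurePreserving_prodAssoc volume volume volume)
    exact Measure.measurePreserving_swap.prod (MeasurePreserving.id volume)
  refine ⟨MeasurableEquiv.prodAssoc.trans (MeasurableEquiv.prodCongr (MeasurableEquiv.refl α) e₁),
    ?_, fun a b => rfl⟩
  exact (measurePreserving_prodAssoc volume volume volume).trans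
    ((MeasurePreserving.id volume).prod h₁)

variable {E : Type*} [MeasureSpace E] [SFinite (volume : Measure E)]
variable {V : Type*} [NormedAddCommGroup V] [NormedSpace ℝ V]

lemma integral_quadruple {f : E × E × E × E → V} (hf : Integrable f) :
    ∫ s, f s = ∫ a : E × E, ∫ b : E × E, f (a.1, b.1, a.2, b.2) := by
  obtain ⟨e, he, hef⟩ := measurePreserving_prodProdProdComm (α := E) (β := E) (γ := E) (δ := E)
  have hi : Integrable (fun q => f (e q)) := he.integrable_comp_of_integrable hf
  rw [← he.integral_comp', Measure.volume_eq_prod, integral_prod _ hi]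
  simp only [hef]

lemma integral_quadruple_symm {f : E × E × E × E → V} (hf : Integrable f) :
    ∫ s, f s = ∫ b : E × E, ∫ a : E × E, f (a.1, b.1, a.2, b.2) := by
  obtain ⟨e, he, hef⟩ := measurePreserving_prodProdProdComm (α := E) (β := E) (γ := E) (δ := E)
  have hi : Integrable (fun q => f (e q)) := he.integrable_comp_of_integrable hf
  rw [← he.integral_comp', Measure.volume_eq_prod, integral_prod_symm _ hi]
  simp only [hef]

variable {R : Type*} [NormedRing R] {α β : Type*} [MeasureSpace α] [MeasureSpace β]

lemma norm_sandwich_le {B₁ B₂ B₃ : R} (h₁ : ‖B₁‖ ≤ 1) (h₂ : ‖B₂‖ ≤ 1) (h₃ : ‖B₃‖ ≤ 1)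
    (P Q : R) : ‖B₁ * P * B₂ * Q * B₃‖ ≤ ‖P‖ * ‖Q‖ := by
  refine (norm_mul_le _ _).trans ((mul_le_of_le_one_right (norm_nonneg _) h₃).trans ?_)
  refine (norm_mul_le _ _).trans (mul_le_mul_of_nonneg_right ?_ (norm_nonneg _))
  refine (norm_mul_le _ _).trans ((mul_le_of_le_one_right (norm_nonneg _) h₂).trans ?_)
  exact (norm_mul_le _ _).trans (mul_le_of_le_one_left (norm_nonneg _) h₁)

lemma integrable_prod_sandwich {f : α → R} {g : β → R} (hf : Integrable f) (hg : Integrable g)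
    (B₁ B₂ B₃ : R) : Integrable fun s : α × β => B₁ * f s.1 * B₂ * g s.2 * B₃ :=
  (((hf.const_mul B₁).mul_const B₂).mul_prod hg).mul_const B₃

variable [NormedSpace ℝ R] [IsScalarTower ℝ R R] [SMulCommClass ℝ R R]
  [SFinite (volume : Measure α)] [SFinite (volume : Measure β)]

lemma integral_prod_sandwich {f : α → R} {g : β → R} (hf : Integrable f) (hg : Integrable g)
    (B₁ B₂ B₃ : R) : ∫ s : α × β, B₁ * f s.1 * B₂ * g s.2 * B₃ =
      B₁ * (∫ a, f a) * B₂ * (∫ b, g b) * B₃ := by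
  have h1 : ∀ a, ∫ b, B₁ * f a * B₂ * g b * B₃ = B₁ * f a * (B₂ * (∫ b, g b) * B₃) := by
    intro a
    rw [integral_mul_const_of_integrable (hg.const_mul _), integral_const_mul_of_integrable hg]
    simp only [mul_assoc]
  rw [Measure.volume_eq_prod, integral_prod _ (integrable_prod_sandwich hf hg B₁ B₂ B₃)]
  simp only [h1]
  rw [integral_mul_const_of_integrable (hf.const_mul _), integral_const_mul_of_integrable hf]
  simp only [mul_assoc]

end ProductIntegrals

/-! ### The phase space form of the star product -/

section PhaseSpaceFormula

variable {D n : ℕ} {A : Spacetime D → Fin D → Mat n}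
  (hA : ∀ μ : Fin D, Continuous (fun x => A x μ))
  (hA_herm : ∀ x μ, IsSelfAdjoint (A x μ))

/-- `norm_phase_smul` for matrices: the operator norm is not syntactically the norm of an abstract
normed space, which rewriting requires. -/
lemma norm_phase_smul_mat (t : ℝ) (M : Mat n) : ‖phase t • M‖ = ‖M‖ := norm_phase_smul t M

lemma continuous_phase_smul {α : Type*} [TopologicalSpace α] {f : α → ℝ} {g : α → Mat n}
    (hf : Continuous f) (hg : Continuous g) : Continuous fun a => phase (f a) • g a := by
  fun_prop

/-- The phases are distributed so that the Fourier transforms of the two symbols appear. -/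
lemma starIntegrand_eq (F G : Spacetime D → Spacetime D → Mat n) (x p y k y' k' : Spacetime D) :
    starIntegrand A F G x p (y, k, y', k') = phase (inner ℝ p (y + y')) •
      ((transporter A x (x - (1 / 2 : ℝ) • (y + y')) *
        transporter A (x - (1 / 2 : ℝ) • (y + y')) (x - (1 / 2 : ℝ) • y')) *
        (phase (-inner ℝ y k) • F (x - (1 / 2 : ℝ) • y') k) *
        (transporter A (x - (1 / 2 : ℝ) • y') (x + (1 / 2 : ℝ) • (y - y')) *
        transporter A (x + (1 / 2 : ℝ) • (y - y')) (x + (1 / 2 : ℝ) • y)) *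
        (phase (-inner ℝ y' k') • G (x + (1 / 2 : ℝ) • y) k') *
        (transporter A (x + (1 / 2 : ℝ) • y) (x + (1 / 2 : ℝ) • (y + y')) *
        transporter A (x + (1 / 2 : ℝ) • (y + y')) x)) := by
  have hphase : phase (-inner ℝ y (k - p) - inner ℝ y' (k' - p)) =
      phase (inner ℝ p (y + y')) * (phase (-inner ℝ y' k') * phase (-inner ℝ y k)) := by
    rw [← phase_add, ← phase_add, inner_sub_right, inner_sub_right, inner_add_right,
      real_inner_comm p y, real_inner_comm p y']
    congr 1; ring
  simp only [starIntegrand]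
  rw [hphase]
  simp only [mul_smul_comm, smul_mul_assoc, smul_smul, mul_assoc]

include hA hA_herm

lemma norm_transporter_mul_le_one (a b c d : Spacetime D) :
    ‖transporter A a b * transporter A c d‖ ≤ 1 :=
  (norm_mul_le _ _).trans (mul_le_one₀ (norm_transporter_le_one hA hA_herm _ _) (norm_nonneg _)
    (norm_transporter_le_one hA hA_herm _ _))

lemma norm_starIntegrand_le (F G : Spacetime D → Spacetime D → Mat n)
    (x p y k y' k' : Spacetime D) :
    ‖starIntegrand A F G x p (y, k, y', k')‖ ≤
      ‖F (x - (1 / 2 : ℝ) • y') k‖ * ‖G (x + (1 / 2 : ℝ) • y) k'‖ := by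
  rw [starIntegrand_eq, norm_phase_smul_mat]
  refine (norm_sandwich_le (norm_transporter_mul_le_one hA hA_herm _ _ _ _)
    (norm_transporter_mul_le_one hA hA_herm _ _ _ _)
    (norm_transporter_mul_le_one hA hA_herm _ _ _ _) _ _).trans ?_
  rw [norm_phase_smul_mat, norm_phase_smul_mat]

lemma integrable_starIntegrand {F G : Spacetime D → Spacetime D → Mat n} (hF : IsSchwartz F)
    (hG : IsSchwartz G) (x p : Spacetime D) : Integrable (starIntegrand A F G x p) := by
  obtain ⟨C₁, h₁, hb₁⟩ := hF.exists_bound 1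
  obtain ⟨C₂, h₂, hb₂⟩ := hG.exists_bound 1
  have hi : Integrable fun s : Spacetime D × Spacetime D × Spacetime D × Spacetime D =>
      C₁ * C₂ * (decayWeight (x + (1 / 2 : ℝ) • s.1) * (decayWeight s.2.1 *
        (decayWeight (x - (1 / 2 : ℝ) • s.2.2.1) * decayWeight s.2.2.2))) :=
    ((integrable_decayWeight_half' x).mul_prod (integrable_decayWeight.mul_prod
      ((integrable_decayWeight_half x).mul_prod integrable_decayWeight))).const_mul _
  refine hi.mono' (Continuous.aestronglyMeasurable ?_) (ae_of_all _ ?_)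
  · have hFc : Continuous fun s : Spacetime D × Spacetime D × Spacetime D × Spacetime D =>
        F (x - (1 / 2 : ℝ) • s.2.2.1) s.2.1 := hF.continuous_comp (by fun_prop) (by fun_prop)
    have hGc : Continuous fun s : Spacetime D × Spacetime D × Spacetime D × Spacetime D =>
        G (x + (1 / 2 : ℝ) • s.1) s.2.2.2 := hG.continuous_comp (by fun_prop) (by fun_prop)
    have hU := fun {f g : Spacetime D × Spacetime D × Spacetime D × Spacetime D → Spacetime D}
      (hf : Continuous f) (hg : Continuous g) => continuous_transporter_comp hA hf hg
    unfold starIntegrand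
    refine continuous_phase_smul (by fun_prop) ?_
    refine Continuous.mul (Continuous.mul (Continuous.mul (Continuous.mul (Continuous.mul
      (Continuous.mul (Continuous.mul ?_ ?_) hFc) ?_) ?_) hGc) ?_) ?_ <;>
    exact hU (by fun_prop) (by fun_prop)
  · rintro ⟨y, k, y', k'⟩
    refine (norm_starIntegrand_le hA hA_herm F G x p y k y' k').trans ?_
    refine (mul_le_mul (hb₁ _ _) (hb₂ _ _) (norm_nonneg _) ?_).trans (le_of_eq (by ring))
    exact mul_nonneg h₁ (pow_nonneg (mul_nonneg (decayWeight_pos _).le (decayWeight_pos _).le) _)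

omit hA hA_herm in
/-- The change of variables from the differences `(y, y')` of three points
`a = x - (y + y')/2`, `u`, `b = x + (y + y')/2` to `w = b - a` and `u`. -/
lemma measurePreserving_sum_midpoint (x : Spacetime D) :
    MeasurePreserving fun q : Spacetime D × Spacetime D =>
      (q.1 + q.2, x + (1 / 2 : ℝ) • (q.1 - q.2)) := by
  have h1 : MeasurePreserving (fun q : Spacetime D × Spacetime D => (q.1, q.1 + q.2)) :=
    measurePreserving_prod_add volume volume
  have h2 : MeasurePreserving (Prod.swap : Spacetime D × Spacetime D → _) :=
    Measure.measurePreserving_swap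
  have h3 : MeasurePreserving (fun q : Spacetime D × Spacetime D =>
      (q.1, q.2 + (x - (1 / 2 : ℝ) • q.1))) :=
    (MeasurePreserving.id volume).skew_product
      (g := fun w u : Spacetime D => u + (x - (1 / 2 : ℝ) • w))
      (by exact Continuous.measurable (by fun_prop))
      (ae_of_all _ fun w => (measurePreserving_add_right volume _).map_eq)
  convert (h3.comp h2).comp h1 using 1
  funext q
  simp only [Function.comp_apply, Prod.swap, Prod.mk.injEq, true_and]
  module

/-- Integrating out the momenta turns the two symbols into the kernels of the two operators. -/
lemma integral_starIntegrand {X Y : Op D n} (hX : HasSchwartzSymbol A X)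
    (hY : HasSchwartzSymbol A Y) {K L : Spacetime D → Spacetime D → Mat n} (hK : HasKernel X K)
    (hL : HasKernel Y L) (x p : Spacetime D) :
    ∫ s, starIntegrand A (weylSymbol A X) (weylSymbol A Y) x p s =
      (((2 * Real.pi) ^ (2 * D) : ℝ) : ℂ) •
        ∫ w, phase (inner ℝ p w) • wignerKernel A (prodKernel K L) x w := by
  have hF : IsSchwartz (weylSymbol A X) := hX.schwartz
  have hG : IsSchwartz (weylSymbol A Y) := hY.schwartz
  have hKd := hX.isDecayingKernel hA hA_herm hK
  have hLd := hY.isDecayingKernel hA hA_herm hL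
  set H : Spacetime D × Spacetime D → Mat n := fun q => phase (inner ℝ p q.1) •
    (transporter A x (x - (1 / 2 : ℝ) • q.1) *
      (K (x - (1 / 2 : ℝ) • q.1) q.2 * L q.2 (x + (1 / 2 : ℝ) • q.1)) *
      transporter A (x + (1 / 2 : ℝ) • q.1) x) with hH_def
  have hHc : Continuous H := by
    refine continuous_phase_smul (by fun_prop)
      (Continuous.mul (Continuous.mul ?_ (Continuous.mul ?_ ?_)) ?_)
    · exact continuous_transporter_comp hA (by fun_prop) (by fun_prop)
    · exact hK.continuous.comp (by fun_prop : Continuous fun q : Spacetime D × Spacetime D =>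
        (x - (1 / 2 : ℝ) • q.1, q.2))
    · exact hL.continuous.comp (by fun_prop : Continuous fun q : Spacetime D × Spacetime D =>
        (q.2, x + (1 / 2 : ℝ) • q.1))
    · exact continuous_transporter_comp hA (by fun_prop) (by fun_prop)
  have hHi : Integrable H := by
    obtain ⟨C, hC, hb⟩ := hKd.exists_bound_mul hLd
    refine (((integrable_decayWeight_half x).mul_prod integrable_decayWeight).const_mul C).mono'
      hHc.aestronglyMeasurable (ae_of_all _ fun q => ?_)
    simp only [hH_def]
    rw [norm_phase_smul_mat]
    refine (norm_mul_le _ _).trans ((mul_le_of_le_one_right (norm_nonneg _)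
      (norm_transporter_le_one hA hA_herm _ _)).trans ?_)
    refine (norm_mul_le _ _).trans ((mul_le_of_le_one_left (norm_nonneg _)
      (norm_transporter_le_one hA hA_herm _ _)).trans ((hb _ _ _).trans ?_))
    rw [← mul_assoc C (decayWeight (x - (1 / 2 : ℝ) • q.1)) (decayWeight q.2)]
    refine mul_le_mul_of_nonneg_right (mul_le_mul_of_nonneg_left ?_ hC) (decayWeight_pos _).le
    exact mul_le_of_le_one_right (decayWeight_pos _).le (decayWeight_le_one _)
  -- the momentum integrals
  have hinner : ∀ a : Spacetime D × Spacetime D,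
      ∫ b : Spacetime D × Spacetime D,
        starIntegrand A (weylSymbol A X) (weylSymbol A Y) x p (a.1, b.1, a.2, b.2) =
      (((2 * Real.pi) ^ (2 * D) : ℝ) : ℂ) • H (a.1 + a.2, x + (1 / 2 : ℝ) • (a.1 - a.2)) := by
    rintro ⟨y, y'⟩
    have hphase : ∀ {F : Spacetime D → Spacetime D → Mat n} (_ : IsSchwartz F) (z y : Spacetime D),
        Integrable fun k => phase (-inner ℝ y k) • F z k := fun hF z y => by
      have hc := hF.continuous_right z
      exact (hF.integrable_right z).mono (Continuous.aestronglyMeasurable (by fun_prop))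
        (ae_of_all _ fun k => by rw [norm_phase_smul_mat])
    simp only [starIntegrand_eq]
    rw [integral_smul, integral_prod_sandwich (hphase hF _ _) (hphase hG _ _)]
    change phase _ • (_ * momentumFourier (weylSymbol A X) (x - (1 / 2 : ℝ) • y') y * _ *
      momentumFourier (weylSymbol A Y) (x + (1 / 2 : ℝ) • y) y' * _) = _
    rw [momentumFourier_weylSymbol hA hA_herm hX hK, momentumFourier_weylSymbol hA hA_herm hY hL]
    have eK := kernel_eq_wignerKernel hA hA_herm K (x - (1 / 2 : ℝ) • y') y
    have eL := kernel_eq_wignerKernel hA hA_herm L (x + (1 / 2 : ℝ) • y) y'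
    have p1 : x - (1 / 2 : ℝ) • y' - (1 / 2 : ℝ) • y = x - (1 / 2 : ℝ) • (y + y') := by module
    have p2 : x - (1 / 2 : ℝ) • y' + (1 / 2 : ℝ) • y = x + (1 / 2 : ℝ) • (y - y') := by module
    have p3 : x + (1 / 2 : ℝ) • y - (1 / 2 : ℝ) • y' = x + (1 / 2 : ℝ) • (y - y') := by module
    have p4 : x + (1 / 2 : ℝ) • y + (1 / 2 : ℝ) • y' = x + (1 / 2 : ℝ) • (y + y') := by module
    rw [p1, p2] at eK
    rw [p3, p4] at eL
    simp only [hH_def, eK, eL, mul_smul_comm, smul_mul_assoc, smul_smul, mul_assoc]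
    congr 1
    push_cast
    ring
  rw [integral_quadruple (integrable_starIntegrand hA hA_herm hF hG x p)]
  simp only [hinner]
  rw [integral_smul]
  congr 1
  have hmp := measurePreserving_sum_midpoint x
  have hmap := integral_map hmp.measurable.aemeasurable
    (f := H) (by rw [hmp.map_eq]; exact hHi.aestronglyMeasurable)
  rw [hmp.map_eq] at hmap
  rw [← hmap, Measure.volume_eq_prod, integral_prod _ hHi]
  refine integral_congr_ae (ae_of_all _ fun w => ?_)
  simp only [hH_def]
  have hi := hKd.integrable_mul hLd (x - (1 / 2 : ℝ) • w) (x + (1 / 2 : ℝ) • w)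
  rw [integral_smul, integral_mul_const_of_integrable (hi.const_mul _),
    integral_const_mul_of_integrable hi]
  rfl

end PhaseSpaceFormula

/-! ### The operator form of the star product -/

section OperatorFormula

variable {D n : ℕ} {A : Spacetime D → Fin D → Mat n}
  (hA : ∀ μ : Fin D, Continuous (fun x => A x μ))
  (hA_herm : ∀ x μ, IsSelfAdjoint (A x μ))

/-- Stated for `Mat n` so that rewriting does not have to find the scalar action on maps. -/
lemma mat_smul_apply (c : ℂ) (M : Mat n) (v : Fiber n) : (c • M) v = c • M v := rfl

/-- The product of the matrices `P`, `Q` and of the parallel transporters along the path from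
`a + y + y'` through `a + y` and `a` to `x`, with `Q` inserted at the midpoint of the first segment
and `P` at the midpoint of the second one. -/
def pathSandwich (A : Spacetime D → Fin D → Mat n) (x a y y' : Spacetime D) (P Q : Mat n) :
    Mat n :=
  (transporter A x a * transporter A a (a + (1 / 2 : ℝ) • y)) * P *
    (transporter A (a + (1 / 2 : ℝ) • y) (a + y) *
      transporter A (a + y) (a + y + (1 / 2 : ℝ) • y')) * Q *
    transporter A (a + y + (1 / 2 : ℝ) • y') (a + y + y')

/-- Moves the phases `e^{iqx̂}`, `e^{iq'x̂}` and the Fourier phases of `starOpIntegrand` to the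
symbols. -/
lemma sandwich_apply_smul (c₁ c₂ e f g : ℂ) (hefg : e = f * g) (B₁ B₂ B₃ P Q : Mat n)
    (v : Fiber n) :
    e • B₁ (c₁ • P (B₂ (c₂ • Q (B₃ v)))) =
      (c₁ * c₂) • (B₁ * (f • P) * B₂ * (g • Q) * B₃) v := by
  simp only [mul_smul_comm, smul_mul_assoc, mat_smul_apply, mul_apply_eq_comp, map_smul,
    smul_smul, hefg]
  congr 1
  ring

include hA hA_herm

lemma norm_pathSandwich_le (x a y y' : Spacetime D) (P Q : Mat n) :
    ‖pathSandwich A x a y y' P Q‖ ≤ ‖P‖ * ‖Q‖ :=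
  norm_sandwich_le (norm_transporter_mul_le_one hA hA_herm _ _ _ _)
    (norm_transporter_mul_le_one hA hA_herm _ _ _ _) (norm_transporter_le_one hA hA_herm _ _) P Q

lemma starOpIntegrand_eq (F G : Spacetime D → Spacetime D → Mat n) (x : Spacetime D)
    (ψ : Spacetime D → Fiber n) (w q y q' y' z k z' k' : Spacetime D) :
    starOpIntegrand A F G x ψ w (q, y, q', y') (z, k, z', k') =
      (phase (inner ℝ q (x - (1 / 2 : ℝ) • w + (1 / 2 : ℝ) • y)) *
        phase (inner ℝ q' (x - (1 / 2 : ℝ) • w + y + (1 / 2 : ℝ) • y'))) •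
      (pathSandwich A x (x - (1 / 2 : ℝ) • w) y y'
        (phase (-(inner ℝ y k + inner ℝ q z)) • F z k)
        (phase (-(inner ℝ y' k' + inner ℝ q' z')) • G z' k'))
        (expIPi A (-(1 / 2 : ℝ) • w) ψ (x - (1 / 2 : ℝ) • w + y + y')) := by
  have hE := fun y (φ : Spacetime D → Fiber n) u => expIPi_apply hA hA_herm y φ u
  have e0 : x + -(1 / 2 : ℝ) • w = x - (1 / 2 : ℝ) • w := by module
  have e1 : x - (1 / 2 : ℝ) • w + (1 / 2 : ℝ) • y + (1 / 2 : ℝ) • y =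
    x - (1 / 2 : ℝ) • w + y := by module
  have e2 : x - (1 / 2 : ℝ) • w + y + (1 / 2 : ℝ) • y' + (1 / 2 : ℝ) • y' =
    x - (1 / 2 : ℝ) • w + y + y' := by module
  rw [pathSandwich, ← sandwich_apply_smul _ _ (phase (-(inner ℝ y k + inner ℝ q z + inner ℝ y' k' +
    inner ℝ q' z')))]
  · simp only [starOpIntegrand, starWord, Function.comp_apply]
    rw [hE, e0, hE]
    simp only [expIX, constOp]
    rw [hE, e1, hE]
    simp only [expIX, constOp, mul_apply_eq_comp]
    rw [hE _ _ (x - (1 / 2 : ℝ) • w + y + (1 / 2 : ℝ) • y'), e2]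
  · rw [← phase_add]
    congr 1
    ring

/-- Integrating over the phase space variables replaces the symbols by their Fourier transforms; the
integral converges absolutely. -/
lemma integral_starOpIntegrand {F G : Spacetime D → Spacetime D → Mat n} (hF : IsSchwartz F)
    (hG : IsSchwartz G) (x : Spacetime D) (ψ : Spacetime D → Fiber n) (w q y q' y' : Spacetime D) :
    Integrable (starOpIntegrand A F G x ψ w (q, y, q', y')) ∧
    starOpInner A F G x ψ w (q, y, q', y') =
      (phase (inner ℝ q (x - (1 / 2 : ℝ) • w + (1 / 2 : ℝ) • y)) *
        phase (inner ℝ q' (x - (1 / 2 : ℝ) • w + y + (1 / 2 : ℝ) • y'))) •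
      (pathSandwich A x (x - (1 / 2 : ℝ) • w) y y' (phaseSpaceFourier F q y)
        (phaseSpaceFourier G q' y'))
        (expIPi A (-(1 / 2 : ℝ) • w) ψ (x - (1 / 2 : ℝ) • w + y + y')) := by
  have hphase : ∀ {F : Spacetime D → Spacetime D → Mat n} (_ : IsSchwartz F) (q y : Spacetime D),
      Integrable fun s : Spacetime D × Spacetime D =>
        phase (-(inner ℝ y s.2 + inner ℝ q s.1)) • F s.1 s.2 := fun hF q y =>
    hF.integrable.mono (continuous_phase_smul (by fun_prop) hF.continuous).aestronglyMeasurable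
      (ae_of_all _ fun k => by rw [norm_phase_smul_mat])
  set c := phase (inner ℝ q (x - (1 / 2 : ℝ) • w + (1 / 2 : ℝ) • y)) *
    phase (inner ℝ q' (x - (1 / 2 : ℝ) • w + y + (1 / 2 : ℝ) • y'))
  set v := expIPi A (-(1 / 2 : ℝ) • w) ψ (x - (1 / 2 : ℝ) • w + y + y')
  let S : (Spacetime D × Spacetime D) × (Spacetime D × Spacetime D) → Mat n := fun s =>
    pathSandwich A x (x - (1 / 2 : ℝ) • w) y y'
      (phase (-(inner ℝ y s.1.2 + inner ℝ q s.1.1)) • F s.1.1 s.1.2)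
      (phase (-(inner ℝ y' s.2.2 + inner ℝ q' s.2.1)) • G s.2.1 s.2.2)
  have hSi : Integrable S := integrable_prod_sandwich (hphase hF q y) (hphase hG q' y') _ _ _
  have hS : ∫ s, S s = pathSandwich A x (x - (1 / 2 : ℝ) • w) y y' (phaseSpaceFourier F q y)
      (phaseSpaceFourier G q' y') :=
    integral_prod_sandwich (hphase hF q y) (hphase hG q' y') _ _ _
  have hmp : MeasurePreserving (MeasurableEquiv.prodAssoc :
      (Spacetime D × Spacetime D) × (Spacetime D × Spacetime D) ≃ᵐ _) :=
    measurePreserving_prodAssoc volume volume volume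
  have heq : ∀ s, starOpIntegrand A F G x ψ w (q, y, q', y') (MeasurableEquiv.prodAssoc s) =
      c • S s v := fun s =>
    starOpIntegrand_eq hA hA_herm F G x ψ w q y q' y' s.1.1 s.1.2 s.2.1 s.2.2
  have hSv : Integrable fun s => c • S s v :=
    (ContinuousLinearMap.integrable_comp (ContinuousLinearMap.apply ℂ (Fiber n) v) hSi).smul c
  constructor
  · rw [← hmp.integrable_comp_emb (MeasurableEquiv.measurableEmbedding _)]
    exact hSv.congr (ae_of_all _ fun s => (heq s).symm)
  · rw [starOpInner, ← hmp.integral_comp']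
    simp only [heq]
    rw [integral_smul, ← ContinuousLinearMap.integral_apply hSi, hS]

lemma integrable_starOpInner {F G : Spacetime D → Spacetime D → Mat n} (hF : IsSchwartz F)
    (hG : IsSchwartz G) (x : Spacetime D) {ψ : Spacetime D → Fiber n} (hψ : Continuous ψ)
    (hψc : HasCompactSupport ψ) (w : Spacetime D) : Integrable (starOpInner A F G x ψ w) := by
  obtain ⟨C₁, h₁, hb₁⟩ := hF.phaseSpaceFourier.exists_bound 1
  obtain ⟨C₂, h₂, hb₂⟩ := hG.phaseSpaceFourier.exists_bound 1
  have hφ := continuous_expIPi hA hA_herm (-(1 / 2 : ℝ) • w) hψ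
  obtain ⟨C₃, hb₃⟩ := (hasCompactSupport_expIPi hA hA_herm (-(1 / 2 : ℝ) • w)
    hψc).exists_bound_of_continuous hφ
  have h₃ : 0 ≤ C₃ := (norm_nonneg _).trans (hb₃ 0)
  have hi : Integrable fun s : Spacetime D × Spacetime D × Spacetime D × Spacetime D =>
      C₁ * C₂ * C₃ * (decayWeight s.1 * (decayWeight s.2.1 *
        (decayWeight s.2.2.1 * decayWeight s.2.2.2))) :=
    (integrable_decayWeight.mul_prod (integrable_decayWeight.mul_prod
      (integrable_decayWeight.mul_prod integrable_decayWeight))).const_mul _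
  have heq : starOpInner A F G x ψ w = fun r =>
      (phase (inner ℝ r.1 (x - (1 / 2 : ℝ) • w + (1 / 2 : ℝ) • r.2.1)) *
        phase (inner ℝ r.2.2.1 (x - (1 / 2 : ℝ) • w + r.2.1 + (1 / 2 : ℝ) • r.2.2.2))) •
      (pathSandwich A x (x - (1 / 2 : ℝ) • w) r.2.1 r.2.2.2 (phaseSpaceFourier F r.1 r.2.1)
        (phaseSpaceFourier G r.2.2.1 r.2.2.2))
        (expIPi A (-(1 / 2 : ℝ) • w) ψ (x - (1 / 2 : ℝ) • w + r.2.1 + r.2.2.2)) :=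
    funext fun r =>
      (integral_starOpIntegrand hA hA_herm hF hG x ψ w r.1 r.2.1 r.2.2.1 r.2.2.2).2
  refine hi.mono' (Continuous.aestronglyMeasurable ?_) (ae_of_all _ ?_)
  · rw [heq]
    have hFc : Continuous fun s : Spacetime D × Spacetime D × Spacetime D × Spacetime D =>
        phaseSpaceFourier F s.1 s.2.1 := hF.phaseSpaceFourier.continuous_comp (by fun_prop)
          (by fun_prop)
    have hGc : Continuous fun s : Spacetime D × Spacetime D × Spacetime D × Spacetime D =>
        phaseSpaceFourier G s.2.2.1 s.2.2.2 := hG.phaseSpaceFourier.continuous_comp (by fun_prop)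
          (by fun_prop)
    have hU := fun {f g : Spacetime D × Spacetime D × Spacetime D × Spacetime D → Spacetime D}
      (hf : Continuous f) (hg : Continuous g) => continuous_transporter_comp hA hf hg
    have hM : Continuous fun r : Spacetime D × Spacetime D × Spacetime D × Spacetime D =>
        pathSandwich A x (x - (1 / 2 : ℝ) • w) r.2.1 r.2.2.2 (phaseSpaceFourier F r.1 r.2.1)
          (phaseSpaceFourier G r.2.2.1 r.2.2.2) := by
      unfold pathSandwich
      refine Continuous.mul (Continuous.mul (Continuous.mul (Continuous.mul (Continuous.mul ?_ ?_)
        hFc) (Continuous.mul ?_ ?_)) hGc) ?_ <;>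
      exact hU (by fun_prop) (by fun_prop)
    fun_prop
  · rintro ⟨q, y, q', y'⟩
    rw [(integral_starOpIntegrand hA hA_herm hF hG x ψ w q y q' y').2, norm_smul, norm_mul,
      norm_phase, norm_phase, one_mul, one_mul]
    refine (ContinuousLinearMap.le_opNorm _ _).trans ?_
    have h := norm_pathSandwich_le hA hA_herm x (x - (1 / 2 : ℝ) • w) y y'
      (phaseSpaceFourier F q y) (phaseSpaceFourier G q' y')
    have hw := mul_nonneg h₁ (pow_nonneg (mul_nonneg (decayWeight_pos q).le
      (decayWeight_pos y).le) 1)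
    have hw' := mul_nonneg h₂ (pow_nonneg (mul_nonneg (decayWeight_pos q').le
      (decayWeight_pos y').le) 1)
    refine (mul_le_mul (h.trans (mul_le_mul (hb₁ q y) (hb₂ q' y') (norm_nonneg _) hw)) (hb₃ _)
      (norm_nonneg _) (mul_nonneg hw hw')).trans (le_of_eq ?_)
    ring

omit hA hA_herm in
lemma measurePreserving_partial_sums (a : Spacetime D) :
    MeasurePreserving fun q : Spacetime D × Spacetime D => (a + q.1, a + q.1 + q.2) :=
  (measurePreserving_add_left volume a).skew_product
    (g := fun y y' : Spacetime D => a + y + y')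
    (by exact Continuous.measurable (by fun_prop))
    (ae_of_all _ fun y => (measurePreserving_add_left volume (a + y)).map_eq)

/-- Integrating over `q, q'` undoes the Fourier transforms in the positions of the symbols; what
remains are the kernels of the two operators, that is the operator product itself. -/
lemma integral_starOpInner {X Y : Op D n} (hX : HasSchwartzSymbol A X)
    (hY : HasSchwartzSymbol A Y) {K L : Spacetime D → Spacetime D → Mat n} (hK : HasKernel X K)
    (hL : HasKernel Y L) (hXY : HasKernel (X ∘ Y) (prodKernel K L)) (x : Spacetime D)
    {ψ : Spacetime D → Fiber n} (hψ : Continuous ψ)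
    (hψc : HasCompactSupport ψ) (w : Spacetime D) :
    ∫ r, starOpInner A (weylSymbol A X) (weylSymbol A Y) x ψ w r =
      (((2 * Real.pi) ^ (4 * D) : ℝ) : ℂ) • weylSandwich A (X ∘ Y) w ψ x := by
  have hF : IsSchwartz (weylSymbol A X) := hX.schwartz
  have hG : IsSchwartz (weylSymbol A Y) := hY.schwartz
  have hKd := hX.isDecayingKernel hA hA_herm hK
  have hLd := hY.isDecayingKernel hA hA_herm hL
  set a := x - (1 / 2 : ℝ) • w with ha
  set φ := expIPi A (-(1 / 2 : ℝ) • w) ψ with hφ_def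
  have hφ : Continuous φ := continuous_expIPi hA hA_herm _ hψ
  have hφc : HasCompactSupport φ := hasCompactSupport_expIPi hA hA_herm _ hψc
  set H : Spacetime D × Spacetime D → Fiber n := fun q =>
    transporter A x a ((K a q.1 * L q.1 q.2) (φ q.2)) with hH_def
  have hi := hKd.integrable_mul_apply hLd hφ hφc a
  have hHi : Integrable H := (transporter A x a).integrable_comp hi
  have hH : ∫ q, H q = weylSandwich A (X ∘ Y) w ψ x := by
    rw [hH_def, (transporter A x a).integral_comp_comm hi, hKd.integral_mul_apply hLd hφ hφc]
    rw [weylSandwich, Function.comp_apply, Function.comp_apply, expIPi_apply hA hA_herm,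
      hXY.apply _ hφ hφc]
    have e0 : x + -(1 / 2 : ℝ) • w = a := by rw [ha]; module
    rw [e0]
  have hinner : ∀ b : Spacetime D × Spacetime D, ∫ c : Spacetime D × Spacetime D,
      starOpInner A (weylSymbol A X) (weylSymbol A Y) x ψ w (c.1, b.1, c.2, b.2) =
      (((2 * Real.pi) ^ (4 * D) : ℝ) : ℂ) • H (a + b.1, a + b.1 + b.2) := by
    rintro ⟨y, y'⟩
    have hphase : ∀ {F : Spacetime D → Spacetime D → Mat n} (_ : IsSchwartz F) (z y : Spacetime D),
        Integrable fun q => phase (inner ℝ q z) • phaseSpaceFourier F q y := fun hF z y => by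
      obtain ⟨C, hC, hb⟩ := hF.phaseSpaceFourier.exists_bound 1
      refine (integrable_decayWeight.const_mul C).mono' (continuous_phase_smul (by fun_prop)
        (hF.phaseSpaceFourier.continuous.comp
          (by fun_prop : Continuous fun q : Spacetime D => (q, y)))).aestronglyMeasurable
        (ae_of_all _ fun q => ?_)
      rw [norm_phase_smul_mat]
      refine (hb q y).trans (mul_le_mul_of_nonneg_left ?_ hC)
      rw [pow_one]
      exact mul_le_of_le_one_right (decayWeight_pos _).le (decayWeight_le_one _)
    have heq : ∀ c : Spacetime D × Spacetime D,
        starOpInner A (weylSymbol A X) (weylSymbol A Y) x ψ w (c.1, y, c.2, y') =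
        (pathSandwich A x a y y' (phase (inner ℝ c.1 (a + (1 / 2 : ℝ) • y)) •
            phaseSpaceFourier (weylSymbol A X) c.1 y)
          (phase (inner ℝ c.2 (a + y + (1 / 2 : ℝ) • y')) •
            phaseSpaceFourier (weylSymbol A Y) c.2 y')) (φ (a + y + y')) := by
      intro c
      rw [(integral_starOpIntegrand hA hA_herm hF hG x ψ w c.1 y c.2 y').2, ← mat_smul_apply]
      congr 1
      simp only [pathSandwich, mul_smul_comm, smul_mul_assoc, smul_smul, ← ha]
      rw [mul_comm (phase _)]
    simp only [heq]
    unfold pathSandwich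
    rw [← ContinuousLinearMap.integral_apply
      (integrable_prod_sandwich (hphase hF _ _) (hphase hG _ _) _ _ _),
      integral_prod_sandwich (hphase hF _ _) (hphase hG _ _)]
    have e1 := hF.integral_phaseSpaceFourier (a + (1 / 2 : ℝ) • y) y
    have e2 := hG.integral_phaseSpaceFourier (a + y + (1 / 2 : ℝ) • y') y'
    rw [momentumFourier_weylSymbol hA hA_herm hX hK] at e1
    rw [momentumFourier_weylSymbol hA hA_herm hY hL] at e2
    have eK := kernel_eq_wignerKernel hA hA_herm K (a + (1 / 2 : ℝ) • y) y
    have eL := kernel_eq_wignerKernel hA hA_herm L (a + y + (1 / 2 : ℝ) • y') y'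
    have p1 : a + (1 / 2 : ℝ) • y - (1 / 2 : ℝ) • y = a := by module
    have p2 : a + (1 / 2 : ℝ) • y + (1 / 2 : ℝ) • y = a + y := by module
    have p3 : a + y + (1 / 2 : ℝ) • y' - (1 / 2 : ℝ) • y' = a + y := by module
    have p4 : a + y + (1 / 2 : ℝ) • y' + (1 / 2 : ℝ) • y' = a + y + y' := by module
    rw [p1, p2] at eK
    rw [p3, p4] at eL
    rw [e1, e2]
    simp only [hH_def]
    rw [← mul_apply_eq_comp, eK, eL, ← mat_smul_apply]
    simp only [mul_smul_comm, smul_mul_assoc, smul_smul, mul_assoc]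
    congr 2
    push_cast
    ring
  rw [integral_quadruple_symm (integrable_starOpInner hA hA_herm hF hG x hψ hψc w)]
  simp only [hinner]
  rw [integral_smul, ← hH]
  congr 1
  have hmp := measurePreserving_partial_sums a
  have hmap := integral_map hmp.measurable.aemeasurable
    (f := H) (by rw [hmp.map_eq]; exact hHi.aestronglyMeasurable)
  rw [hmp.map_eq] at hmap
  exact hmap.symm

lemma continuous_weylSandwich {T : Op D n} {K : Spacetime D → Spacetime D → Mat n}
    (hT : HasKernel T K) (hK : IsDecayingKernel K) (x : Spacetime D) {ψ : Spacetime D → Fiber n}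
    (hψ : Continuous ψ) (hψc : HasCompactSupport ψ) :
    Continuous fun w => weylSandwich A T w ψ x := by
  obtain ⟨C, hC, hb⟩ := hK.bound
  simp only [weylSandwich_apply hA hA_herm hT _ hψ hψc]
  have hKc := fun {α : Type} [TopologicalSpace α] {f g : α → Spacetime D} (hf : Continuous f)
    (hg : Continuous g) => hK.continuous.comp (hf.prodMk hg)
  refine Continuous.clm_apply (continuous_transporter_comp hA (by fun_prop) (by fun_prop)) ?_
  refine continuous_of_dominated (bound := fun t => C * ‖ψ t‖) (fun w => ?_)
    (fun w => ae_of_all _ fun t => ?_)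
    ((hψ.integrable_of_hasCompactSupport hψc).norm.const_mul C) (ae_of_all _ fun t => ?_)
  · exact Continuous.aestronglyMeasurable (Continuous.clm_apply (hKc (by fun_prop) (by fun_prop))
      (Continuous.clm_apply (continuous_transporter_comp hA (by fun_prop) (by fun_prop)) hψ))
  · refine (ContinuousLinearMap.le_opNorm _ _).trans (mul_le_mul ((hb _ _).trans
      (mul_le_of_le_one_right hC (mul_le_one₀ (decayWeight_le_one _) (decayWeight_pos _).le
        (decayWeight_le_one _)))) ?_ (norm_nonneg _) hC)
    exact (ContinuousLinearMap.le_opNorm _ _).trans (mul_le_of_le_one_left (norm_nonneg _)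
      (norm_transporter_le_one hA hA_herm _ _))
  · exact Continuous.clm_apply (hKc (by fun_prop) (by fun_prop))
      (Continuous.clm_apply (continuous_transporter_comp hA (by fun_prop) (by fun_prop))
        continuous_const)

/-- The bound is integrable in `w` and depends on the wave function only through its `L¹` norm,
hence it is uniform along a delta sequence. -/
lemma exists_norm_weylSandwich_le {T : Op D n} {K : Spacetime D → Spacetime D → Mat n}
    (hT : HasKernel T K) (hK : IsDecayingKernel K) :
    ∃ C, 0 ≤ C ∧ ∀ (x w : Spacetime D) (ψ : Spacetime D → Fiber n), Continuous ψ →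
      HasCompactSupport ψ →
      ‖weylSandwich A T w ψ x‖ ≤ C * decayWeight (x - (1 / 2 : ℝ) • w) * ∫ t, ‖ψ t‖ := by
  obtain ⟨C, hC, hb⟩ := hK.bound
  refine ⟨C, hC, fun x w ψ hψ hψc => ?_⟩
  rw [weylSandwich_apply hA hA_herm hT _ hψ hψc]
  refine (ContinuousLinearMap.le_opNorm _ _).trans ((mul_le_of_le_one_left (norm_nonneg _)
    (norm_transporter_le_one hA hA_herm _ _)).trans ?_)
  rw [← integral_const_mul]
  refine norm_integral_le_of_norm_le ((hψ.integrable_of_hasCompactSupport hψc).norm.const_mul _)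
    (ae_of_all _ fun t => ?_)
  refine (ContinuousLinearMap.le_opNorm _ _).trans (mul_le_mul ((hb _ _).trans
    (mul_le_mul_of_nonneg_left (mul_le_of_le_one_right (decayWeight_pos _).le
      (decayWeight_le_one _)) hC)) ?_ (norm_nonneg _) (mul_nonneg hC (decayWeight_pos _).le))
  exact (ContinuousLinearMap.le_opNorm _ _).trans (mul_le_of_le_one_left (norm_nonneg _)
    (norm_transporter_le_one hA hA_herm _ _))

lemma starOpMiddle_eq {X Y : Op D n} (hX : HasSchwartzSymbol A X)
    (hY : HasSchwartzSymbol A Y) {K L : Spacetime D → Spacetime D → Mat n} (hK : HasKernel X K)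
    (hL : HasKernel Y L) (hXY : HasKernel (X ∘ Y) (prodKernel K L)) (x p : Spacetime D)
    {ψ : Spacetime D → Fiber n} (hψ : Continuous ψ) (hψc : HasCompactSupport ψ) :
    starOpMiddle A (weylSymbol A X) (weylSymbol A Y) x p ψ = fun w =>
      (((2 * Real.pi) ^ (4 * D) : ℝ) : ℂ) •
        (phase (inner ℝ p w) • weylSandwich A (X ∘ Y) w ψ x) := by
  funext w
  rw [starOpMiddle, integral_starOpInner hA hA_herm hX hY hK hL hXY x hψ hψc, smul_comm]

lemma integrable_phase_weylSandwich {T : Op D n} {K : Spacetime D → Spacetime D → Mat n}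
    (hT : HasKernel T K) (hK : IsDecayingKernel K) (x p : Spacetime D)
    {ψ : Spacetime D → Fiber n} (hψ : Continuous ψ) (hψc : HasCompactSupport ψ) :
    Integrable fun w => phase (inner ℝ p w) • weylSandwich A T w ψ x := by
  obtain ⟨C, -, hb⟩ := exists_norm_weylSandwich_le hA hA_herm hT hK
  have hc := continuous_weylSandwich hA hA_herm hT hK x hψ hψc
  refine (((integrable_decayWeight_half x).const_mul C).mul_const (∫ t, ‖ψ t‖)).mono'
    (Continuous.aestronglyMeasurable (by fun_prop)) (ae_of_all _ fun w => ?_)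
  rw [norm_phase_smul]
  exact hb x w ψ hψ hψc

/-- The Weyl symbol as a limit of integrals of matrix elements between `⟨x|` and wave packets:
dominated convergence. -/
lemma tendsto_integral_phase_weylSandwich {T : Op D n} {K : Spacetime D → Spacetime D → Mat n}
    (hT : HasKernel T K) (hK : IsDecayingKernel K) (x p : Spacetime D)
    {ρ : ℕ → Spacetime D → ℝ} (hρ : IsDeltaSeq x ρ) (v : Fiber n) :
    Tendsto (fun m => ∫ w, phase (inner ℝ p w) • weylSandwich A T w (packet (ρ m) v) x) atTop
      (𝓝 (weylSymbol A T x p v)) := by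
  obtain ⟨C, hC, hb⟩ := exists_norm_weylSandwich_le hA hA_herm hT hK
  have hnorm : ∀ m, ∫ t, ‖packet (ρ m) v t‖ = ‖v‖ := fun m => by
    simp only [hρ.norm_packet]
    rw [integral_mul_const, hρ.integral_eq_one, one_mul]
  have hW : Integrable fun w => phase (inner ℝ p w) • wignerKernel A K x w :=
    (hK.integrable_wignerKernel hA hA_herm x).mono
      (continuous_phase_smul (by fun_prop)
        ((continuous_wignerKernel hA hK.continuous).uncurry_left x)).aestronglyMeasurable
      (ae_of_all _ fun w => by rw [norm_phase_smul_mat])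
  rw [weylSymbol_eq hA hA_herm hT, ContinuousLinearMap.integral_apply hW]
  refine tendsto_integral_of_dominated_convergence
    (fun w => C * decayWeight (x - (1 / 2 : ℝ) • w) * ‖v‖)
    (fun m => (integrable_phase_weylSandwich hA hA_herm hT hK x p (hρ.continuous_packet m v)
      (hρ.hasCompactSupport_packet m v)).aestronglyMeasurable)
    (((integrable_decayWeight_half x).const_mul C).mul_const _) (fun m => ae_of_all _ fun w => ?_)
    (ae_of_all _ fun w => ?_)
  · rw [norm_phase_smul, ← hnorm m]
    exact hb x w _ (hρ.continuous_packet m v) (hρ.hasCompactSupport_packet m v)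
  · exact (hasMatrixElement_weylSandwich hA hA_herm hT w x ρ hρ v).const_smul _

end OperatorFormula

end

theorem theorem2 (D n : ℕ) (A : Spacetime D → Fin D → Mat n)
    (hA : ∀ μ : Fin D, Continuous (fun x => A x μ))
    (hA_herm : ∀ (x : Spacetime D) (μ : Fin D), IsSelfAdjoint (A x μ))
    (X Y : Op D n) (hX : HasSchwartzSymbol A X) (hY : HasSchwartzSymbol A Y) :
    (∀ x : Spacetime D, WeylConverges A (X ∘ Y) x) ∧
    ∀ x p : Spacetime D,
      starProduct A (weylSymbol A X) (weylSymbol A Y) x p = weylSymbol A (X ∘ Y) x p ∧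
      (∀ (ρ : ℕ → Spacetime D → ℝ) (v : Fiber n), IsDeltaSeq x ρ →
        (∀ m, StarOpConverges A (weylSymbol A X) (weylSymbol A Y) x p (packet (ρ m) v)) ∧
        Tendsto
          (fun m => starOpIntegral A (weylSymbol A X) (weylSymbol A Y) x p (packet (ρ m) v))
          atTop (𝓝 (starProduct A (weylSymbol A X) (weylSymbol A Y) x p v))) ∧
      Integrable (starIntegrand A (weylSymbol A X) (weylSymbol A Y) x p) ∧
      starProduct A (weylSymbol A X) (weylSymbol A Y) x p =
        ((((2 * Real.pi) ^ (2 * D))⁻¹ : ℝ) : ℂ) •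
          ∫ s : Spacetime D × Spacetime D × Spacetime D × Spacetime D,
            starIntegrand A (weylSymbol A X) (weylSymbol A Y) x p s := by
  obtain ⟨K, hKc, hKX⟩ := hX.kernel
  obtain ⟨L, hLc, hLY⟩ := hY.kernel
  have hK : HasKernel X K := hKX ▸ hasKernel_kernelOp hKc
  have hL : HasKernel Y L := hLY ▸ hasKernel_kernelOp hLc
  have hKd := hX.isDecayingKernel hA hA_herm hK
  have hLd := hY.isDecayingKernel hA hA_herm hL
  have hM := hKd.prodKernel hLd
  have hXY : HasKernel (X ∘ Y) (prodKernel K L) := by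
    rw [hKX, hLY]
    exact hKd.hasKernel_comp hLd
  refine ⟨fun x => (weylConverges_iff hA hA_herm hXY x).2
    (hM.integrable_wignerKernel hA hA_herm x), fun x p => ?_⟩
  rw [starProduct_weylSymbol hA hA_herm hX hY]
  refine ⟨rfl, fun ρ v hρ => ⟨fun m => ?_, ?_⟩,
    integrable_starIntegrand hA hA_herm hX.schwartz hY.schwartz x p, ?_⟩
  · have hψ := hρ.continuous_packet m v
    have hψc := hρ.hasCompactSupport_packet m v
    refine ⟨fun w r => (integral_starOpIntegrand hA hA_herm hX.schwartz hY.schwartz x _ w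
      r.1 r.2.1 r.2.2.1 r.2.2.2).1, fun w => integrable_starOpInner hA hA_herm hX.schwartz
      hY.schwartz x hψ hψc w, ?_⟩
    rw [starOpMiddle_eq hA hA_herm hX hY hK hL hXY x p hψ hψc]
    exact Integrable.smul (𝕜 := ℂ) _ (integrable_phase_weylSandwich hA hA_herm hXY hM x p hψ hψc)
  · refine (tendsto_integral_phase_weylSandwich hA hA_herm hXY hM x p hρ v).congr fun m => ?_
    rw [starOpIntegral, starOpMiddle_eq hA hA_herm hX hY hK hL hXY x p (hρ.continuous_packet m v)
      (hρ.hasCompactSupport_packet m v), integral_smul, smul_smul, ← Complex.ofReal_mul,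
      inv_mul_cancel₀ (by positivity), Complex.ofReal_one, one_smul]
  · rw [integral_starIntegrand hA hA_herm hX hY hK hL, smul_smul, ← Complex.ofReal_mul,
      inv_mul_cancel₀ (by positivity), Complex.ofReal_one, one_smul,
      weylSymbol_eq hA hA_herm hXY]
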